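/- All vector spaces are over $\mathbb C$. Let $r\ge 1$, let $W$ be a vector space, write $\mathbf x=(x_1,\dots,x_r)$, $\mathbf x^{\mathbf m}=x_1^{m_1}\cdots x_r^{m_r}$ and $\mathbf z\mathbf y=(z_1y_1,\dots,z_ry_r)$, and put $$\mathcal E(W,r)=\mathrm{Hom}\big(W,W[[x_1^{\pm1},\dots,x_r^{\pm1}]]((x_0))\big).$$ **Locality and products.** A subset $U\subset\mathcal E(W,r)$ is *local* if for all $a,b\in U$ (including $a=b$) there is an integer $k\ge 0$ with $(x_0-y_0)^k a(x_0,\mathbf x)b(y_0,\mathbf y)=(x_0-y_0)^k b(y_0,\mathbf y)a(x_0,\mathbf x)$. An ordered pair $(a,b)$ is *compatible* if for some $k\ge 0$ $$(x_0-y_0)^k a(x_0,\mathbf x)b(y_0,\mathbf y)\in \mathrm{Hom}\big(W,W[[x_1^{\pm1},\dots,x_r^{\pm1},y_1^{\pm1},\dots,y_r^{\pm1}]]((x_0,y_0))\big);$$ mutually local pairs are compatible. For a compatible pair, the components $a_{m_0,\mathbf m}b\in\mathcal E(W,r)$, $(m_0,\mathbf m)\in\mathbb Z\times\mathbb Z^r$,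 are defined, independently of such a $k$, by $$Y_{\mathcal E}(a(y_0,\mathbf y);z_0,\mathbf z)b(y_0,\mathbf y)=\sum_{m_0,\mathbf m}\big(a_{m_0,\mathbf m}b\big)(y_0,\mathbf y)\,z_0^{-m_0-1}\mathbf z^{-\mathbf m}=z_0^{-k}\Big((x_0-y_0)^k a(x_0,\mathbf z\mathbf y)b(y_0,\mathbf y)\Big)\Big|_{x_0=y_0+z_0}.$$ A local subspace $S$ is *closed* if $a_{m_0,\mathbf m}b\in S$ for all $a,b\in S$ and all $(m_0,\mathbf m)$. Let $D_0=\partial/\partial x_0$ and $D_j=x_j\,\partial/\partial x_j$ $(1\le j\le r)$, acting on $\mathcal E(W,r)$. **Toroidal vertex algebras.** An *$(r+1)$-toroidal vertex algebra* is a vector space $V$ with a linear map $Y(\cdot;x_0,\mathbf x):V\to\mathcal E(V,r)$, $Y(v;x_0,\mathbf x)=\sum v_{m_0,\mathbf m}x_0^{-m_0-1}\mathbf x^{-\mathbf m}$, and a vector $\mathbf 1\in V$ such that $Y(\mathbf 1;x_0,\mathbf x)v=v$ and $Y(v;x_0,\mathbf x)\mathbf 1\in V[[x_0,x_1^{\pm1},\dots,x_r^{\pm1}]]$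 for $v\in V$, and such that for $u,v\in V$ $$z_0^{-1}\delta\Big(\tfrac{x_0-y_0}{z_0}\Big)Y(u;x_0,\mathbf z\mathbf y)Y(v;y_0,\mathbf y)-z_0^{-1}\delta\Big(\tfrac{y_0-x_0}{-z_0}\Big)Y(v;y_0,\mathbf y)Y(u;x_0,\mathbf z\mathbf y)=y_0^{-1}\delta\Big(\tfrac{x_0-z_0}{y_0}\Big)Y(Y(u;z_0,\mathbf z)v;y_0,\mathbf y).$$ It is *extended* if it is equipped with linear operators $\mathcal D_0,\dots,\mathcal D_r$ on $V$ with $\mathcal D_i\mathbf 1=0$, $[\mathcal D_0,Y(v;x_0,\mathbf x)]=Y(\mathcal D_0v;x_0,\mathbf x)=\frac{\partial}{\partial x_0}Y(v;x_0,\mathbf x)$ and $[\mathcal D_j,Y(v;x_0,\mathbf x)]=Y(\mathcal D_jv;x_0,\mathbf x)=x_j\frac{\partial}{\partial x_j}Y(v;x_0,\mathbf x)$ for $1\le j\le r$. A *$V$-module* is a vector space $W$ with a linear map $Y_W:V\to\mathcal E(W,r)$ such that $Y_W(\mathbf 1;x_0,\mathbf x)=1_W$ and, for $u,v\in V$, the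 identity above holds with $Y_W(u;\cdot),Y_W(v;\cdot)$ and $Y_W(Y(u;z_0,\mathbf z)v;y_0,\mathbf y)$ in place of the outer $Y$'s; it is *faithful* if $Y_W$ is injective. **Theorem.** Let $U$ be a local subset of $\mathcal E(W,r)$. Let $\langle U\rangle$ be the linear span of the iterated products $$a^{(1)}_{m_0^{(1)},\mathbf m^{(1)}}\cdots a^{(k)}_{m_0^{(k)},\mathbf m^{(k)}}b,\qquad k\ge 0,\ a^{(i)},b\in U\cup\{1_W\},\ (m_0^{(i)},\mathbf m^{(i)})\in\mathbb Z\times\mathbb Z^r .$$ 1. $\langle U\rangle$ is the (unique) smallest closed local subspace of $\mathcal E(W,r)$ containing $U\cup\{1_W\}$. 2. $(\langle U\rangle,Y_{\mathcal E},1_W)$ is an $(r+1)$-toroidal vertex algebra, and $W$ is a faithful $\langle U\rangle$-module with $Y_W(a(x_0,\mathbf x);z_0,\mathbf z)=a(z_0,\mathbf z)$. 3. $\mathbb C[D_0,D_1,\dots,D_r]\langle U\rangle$, with $Y_{\mathcal E}$, the vacuum $1_W$ and $\mathcal D_i=D_i$ $(0\le i\le r)$, is an extended $(r+1)$-toroidal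 vertex algebra, and $W$ is a module for the underlying $(r+1)$-toroidal vertex algebra, with $Y_W(a(x_0,\mathbf x);z_0,\mathbf z)=a(z_0,\mathbf z)$. -/

import Mathlib

namespace Toroidal

/-- `(End W)[[x₀^{±1}, x₁^{±1}, …, x_r^{±1}]]`.  The function `a` stands for the formal series
`a(x₀, x) = ∑ a p m x₀^{-p-1} x^{-m}`, the sum being over all `p ∈ ℤ` and `m ∈ ℤ^r`. -/
abbrev FormalDist (r : ℕ) (W : Type*) [AddCommGroup W] [Module ℂ W] : Type _ :=
  ℤ → (Fin r → ℤ) → Module.End ℂ W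

/-- `Hom(W, W[[x₁^{±1}, …, x_r^{±1}]]((x₀)))`, as a subspace of the space of all formal series:
for each `w`, the powers of `x₀` occurring in `a(x₀, x) w` are bounded below. -/
def vertexOpsSubmodule (r : ℕ) (W : Type*) [AddCommGroup W] [Module ℂ W] :
    Submodule ℂ (FormalDist r W) where
  carrier := {a | ∀ w : W, ∃ N : ℤ, ∀ p : ℤ, N ≤ p → ∀ m : Fin r → ℤ, a p m w = 0}
  zero_mem' := fun _ => ⟨0, fun _ _ _ => rfl⟩
  add_mem' := by
    intro a b ha hb w
    obtain ⟨M, hM⟩ := ha w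
    obtain ⟨N, hN⟩ := hb w
    refine ⟨max M N, fun p hp m => ?_⟩
    simp [hM p (le_trans (le_max_left _ _) hp) m, hN p (le_trans (le_max_right _ _) hp) m]
  smul_mem' := by
    intro c a ha w
    obtain ⟨N, hN⟩ := ha w
    exact ⟨N, fun p hp m => by simp [hN p hp m]⟩

/-- The vector space `E(W, r) = Hom(W, W[[x₁^{±1}, …, x_r^{±1}]]((x₀)))`.  For `a` in it,
`a.coeff p m` is the component `a_{p,m} ∈ End W`, the coefficient of `x₀^{-p-1} x^{-m}`. -/
structure VertexOps (r : ℕ) (W : Type*) [AddCommGroup W] [Module ℂ W] where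
  coeff : FormalDist r W
  truncated : coeff ∈ vertexOpsSubmodule r W

section

variable {r : ℕ} {W : Type*} [AddCommGroup W] [Module ℂ W]

/-- `VertexOps r W` is the subspace `vertexOpsSubmodule r W`; its vector space structure is
transported along this bijection. -/
def VertexOps.equivSubmodule : VertexOps r W ≃ vertexOpsSubmodule r W where
  toFun a := ⟨a.coeff, a.truncated⟩
  invFun a := ⟨a.1, a.2⟩

noncomputable instance : AddCommGroup (VertexOps r W) :=
  VertexOps.equivSubmodule.addCommGroup

noncomputable instance : Module ℂ (VertexOps r W) :=
  VertexOps.equivSubmodule.module ℂ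

theorem VertexOps.coeff_zero (p : ℤ) (m : Fin r → ℤ) : (0 : VertexOps r W).coeff p m = 0 := rfl

theorem VertexOps.coeff_add (a b : VertexOps r W) (p : ℤ) (m : Fin r → ℤ) :
    (a + b).coeff p m = a.coeff p m + b.coeff p m := rfl

theorem VertexOps.coeff_smul (c : ℂ) (a : VertexOps r W) (p : ℤ) (m : Fin r → ℤ) :
    (c • a).coeff p m = c • a.coeff p m := rfl

theorem VertexOps.ext_coeff {a b : VertexOps r W}
    (h : ∀ p m w, a.coeff p m w = b.coeff p m w) : a = b := by
  cases a
  cases b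
  congr
  exact funext fun p => funext fun m => LinearMap.ext fun w => h p m w

/-- The identity operator `1_W`, as a constant formal series. -/
def oneOp (r : ℕ) (W : Type*) [AddCommGroup W] [Module ℂ W] : VertexOps r W :=
  ⟨fun p m => if p = -1 ∧ m = 0 then 1 else 0, fun _ => ⟨0, fun p hp m => by
    simp [show p ≠ -1 by omega]⟩⟩

/-- Operator-valued formal series `∑ G p m q n x₀^{-p-1} x^{-m} y₀^{-q-1} y^{-n}`. -/
abbrev FormalDist₂ (r : ℕ) (W : Type*) [AddCommGroup W] [Module ℂ W] : Type _ :=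
  ℤ → (Fin r → ℤ) → ℤ → (Fin r → ℤ) → Module.End ℂ W

/-- The series `(x₀ - y₀)^k G(x₀, x, y₀, y)`. -/
def subPow (k : ℕ) (G : FormalDist₂ r W) : FormalDist₂ r W := fun p m q n =>
  ∑ i ∈ Finset.range (k + 1), ((-1 : ℤ) ^ i * (k.choose i : ℤ)) • G (p + k - i) m (q + i) n

/-- The series `a(x₀, x) b(y₀, y)`. -/
def mulXY (a b : FormalDist r W) : FormalDist₂ r W := fun p m q n => a p m * b q n

/-- The series `b(y₀, y) a(x₀, x)`. -/
def mulYX (a b : FormalDist r W) : FormalDist₂ r W := fun p m q n => b q n * a p m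

/-- `(x₀ - y₀)^k a(x₀, x) b(y₀, y) = (x₀ - y₀)^k b(y₀, y) a(x₀, x)` for some `k ≥ 0`. -/
def MutuallyLocal (a b : FormalDist r W) : Prop :=
  ∃ k : ℕ, subPow k (mulXY a b) = subPow k (mulYX a b)

/-- Local subsets of `VertexOps r W`. -/
def IsLocal (U : Set (VertexOps r W)) : Prop :=
  ∀ a ∈ U, ∀ b ∈ U, MutuallyLocal a.coeff b.coeff

/-- `G ∈ Hom(W, W[[x^{±1}, y^{±1}]]((x₀, y₀)))`, where `((x₀, y₀))` allows only finitely many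
negative powers of `x₀` and of `y₀`. -/
def IsLaurent₂ (G : FormalDist₂ r W) : Prop :=
  ∀ w : W, ∃ N : ℤ, ∀ (p : ℤ) (m : Fin r → ℤ) (q : ℤ) (n : Fin r → ℤ),
    (N ≤ p ∨ N ≤ q) → G p m q n w = 0

/-- The ordered pair `(a, b)` is compatible:
`(x₀ - y₀)^k a(x₀, x) b(y₀, y) ∈ Hom(W, W[[x^{±1}, y^{±1}]]((x₀, y₀)))` for some `k ≥ 0`. -/
def Compatible (a b : VertexOps r W) : Prop :=
  ∃ k : ℕ, IsLaurent₂ (subPow k (mulXY a.coeff b.coeff))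

theorem IsLaurent₂.finite_support {G : FormalDist₂ r W} (hG : IsLaurent₂ G) (c : ℤ → ℤ) (t : ℤ)
    (m n : Fin r → ℤ) (w : W) :
    (Function.support fun p : ℤ => c p • G p m (t - p) n w).Finite := by
  obtain ⟨N, hN⟩ := hG w
  refine (Set.finite_Icc (t - N) N).subset fun p hp => ?_
  by_contra hcon
  apply hp
  have h0 : G p m (t - p) n w = 0 := by
    apply hN
    simp only [Set.mem_Icc, not_and_or, not_le] at hcon
    rcases hcon with h | h
    · right; omega
    · left; omega
  simp [h0]

/-- For `G ∈ Hom(W, W[[x^{±1}, y^{±1}]]((x₀, y₀)))` and `j ≥ 0`, the coefficient of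
`z₀^j z^{-m} y₀^{-s-1} y^{-n}` in `G(y₀ + z₀, z y, y₀, y)`.  Here `x^{-m} y^{-n'}` becomes
`z^{-m} y^{-m-n'}`, and `x₀^{-p-1}` becomes `(y₀ + z₀)^{-p-1}`, expanded in nonnegative powers
of `z₀`. -/
noncomputable def substCoeff (G : FormalDist₂ r W) (hG : IsLaurent₂ G) (j : ℕ)
    (m : Fin r → ℤ) (s : ℤ) (n : Fin r → ℤ) : Module.End ℂ W where
  toFun w := ∑ᶠ p : ℤ, Ring.choose (-p - 1) j • G p m (s - 1 - j - p) (n - m) w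
  map_add' w w' := by
    rw [← finsum_add_distrib (hG.finite_support _ _ _ _ _) (hG.finite_support _ _ _ _ _)]
    exact finsum_congr fun p => by rw [map_add, smul_add]
  map_smul' c w := by
    rw [RingHom.id_apply, smul_finsum' c (hG.finite_support _ _ _ _ _)]
    exact finsum_congr fun p => by rw [map_smul, smul_comm]

/-- The component `a_{m₀,m} b ∈ VertexOps r W`, for a compatible pair `(a, b)`: the coefficient of
`z₀^{-m₀-1} z^{-m}` in
`Y_E(a(y₀,y); z₀, z) b(y₀,y) = z₀^{-k} ((x₀ - y₀)^k a(x₀, z y) b(y₀, y))|_{x₀ = y₀ + z₀}`,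
where `k` is a natural number witnessing the compatibility of `(a, b)` (the result does not depend
on which one).  It vanishes for `m₀ ≥ k`. -/
noncomputable def comp (a b : VertexOps r W) (h : Compatible a b) (m₀ : ℤ) (m : Fin r → ℤ) :
    VertexOps r W :=
  ⟨fun s n =>
    if m₀ < (h.choose : ℤ) then
      substCoeff (subPow h.choose (mulXY a.coeff b.coeff))
        h.choose_spec ((h.choose : ℤ) - 1 - m₀).toNat m s n
    else 0, by
    intro w
    obtain ⟨N, hN⟩ := h.choose_spec w
    refine ⟨2 * N + 1 + (((h.choose : ℤ) - 1 - m₀).toNat : ℤ), fun s hs n => ?_⟩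
    split_ifs with hk
    · refine (finsum_congr fun p => ?_).trans finsum_zero
      rw [hN, smul_zero]
      by_contra hcon
      simp only [not_or, not_le] at hcon
      omega
    · rfl⟩

/-- A (local) subspace `S` is closed if `a_{m₀,m} b ∈ S` for all `a, b ∈ S` and all `(m₀, m)`.
On a local subspace all pairs are compatible. -/
def IsClosedSubspace (S : Submodule ℂ (VertexOps r W)) : Prop :=
  ∀ a ∈ S, ∀ b ∈ S, ∀ (h : Compatible a b) (m₀ : ℤ) (m : Fin r → ℤ), comp a b h m₀ m ∈ S

/-- The iterated products `a⁽¹⁾_{m⁽¹⁾} (a⁽²⁾_{m⁽²⁾} (⋯ (a⁽ᵏ⁾_{m⁽ᵏ⁾} b)))` with `k ≥ 0` and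
`a⁽¹⁾, …, a⁽ᵏ⁾, b ∈ A`. -/
inductive IteratedProduct (A : Set (VertexOps r W)) : VertexOps r W → Prop
  | base (b : VertexOps r W) (hb : b ∈ A) : IteratedProduct A b
  | step (a c : VertexOps r W) (ha : a ∈ A) (hc : IteratedProduct A c) (h : Compatible a c)
      (m₀ : ℤ) (m : Fin r → ℤ) : IteratedProduct A (comp a c h m₀ m)

/-- `⟨U⟩`: the linear span of the iterated products of elements of `U ∪ {1_W}`. -/
noncomputable def generated (U : Set (VertexOps r W)) : Submodule ℂ (VertexOps r W) :=
  Submodule.span ℂ {c | IteratedProduct (U ∪ {oneOp r W}) c}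

variable (r W)

/-- `∂/∂x₀` on `VertexOps r W`. -/
noncomputable def derivZero : Module.End ℂ (VertexOps r W) where
  toFun a := ⟨fun p m => (-(p : ℂ)) • a.coeff (p - 1) m, fun w => by
    obtain ⟨N, hN⟩ := a.truncated w
    exact ⟨N + 1, fun p hp m => by simp [hN (p - 1) (by omega) m]⟩⟩
  map_add' a b := VertexOps.ext_coeff fun p m w => smul_add _ (a.coeff _ m w) (b.coeff _ m w)
  map_smul' c a := VertexOps.ext_coeff fun p m w => smul_comm _ c (a.coeff _ m w)

/-- The Euler operator `x_j ∂/∂x_j` on `VertexOps r W`, for a toroidal variable `x_j`. -/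
noncomputable def eulerOp (j : Fin r) : Module.End ℂ (VertexOps r W) where
  toFun a := ⟨fun p m => (-(m j : ℂ)) • a.coeff p m, fun w => by
    obtain ⟨N, hN⟩ := a.truncated w
    exact ⟨N, fun p hp m => by simp [hN p hp m]⟩⟩
  map_add' a b := VertexOps.ext_coeff fun p m w => smul_add _ (a.coeff _ m w) (b.coeff _ m w)
  map_smul' c a := VertexOps.ext_coeff fun p m w => smul_comm _ c (a.coeff _ m w)

/-- `D₀ = ∂/∂x₀` and `D_j = x_j ∂/∂x_j` for `1 ≤ j ≤ r`. -/
noncomputable def diffOp (i : Fin (r + 1)) : Module.End ℂ (VertexOps r W) :=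
  Fin.cases (derivZero r W) (eulerOp r W) i

variable {r W}

/-- `ℂ[D₀, D₁, …, D_r] S`: the span of all `P(D₀, …, D_r) a` with `a ∈ S`. -/
noncomputable def polyDiff (S : Submodule ℂ (VertexOps r W)) : Submodule ℂ (VertexOps r W) :=
  Submodule.span ℂ
    {x | ∃ P ∈ Algebra.adjoin ℂ (Set.range (diffOp r W)), ∃ a ∈ S, x = P a}

end

/-- The Jacobi identity for `Y : V → Hom(V, V[[x^{±1}]]((x₀)))` and
`YW : V → Hom(W, W[[x^{±1}]]((x₀)))`:
`z₀⁻¹ δ((x₀-y₀)/z₀) YW(u; x₀, zy) YW(v; y₀, y) - z₀⁻¹ δ((y₀-x₀)/(-z₀)) YW(v; y₀, y) YW(u; x₀, zy)`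
`= x₀⁻¹ δ((y₀+z₀)/x₀) YW(Y(u; z₀, z) v; y₀, y)`
(recall `x₀⁻¹ δ((y₀+z₀)/x₀) = y₀⁻¹ δ((x₀-z₀)/y₀)`), written out as the equality of the coefficients
of `x₀^{-p-1} y₀^{-q-1} z₀^{-l-1} z^{-m} y^{-m-n}` on both sides, where binomials are expanded in
nonnegative powers of the second variable.  By lower truncation all sums are finite. -/
def JacobiIdentity {r : ℕ} {V W : Type*} [AddCommGroup V] [Module ℂ V] [AddCommGroup W]
    [Module ℂ W] (Y : V →ₗ[ℂ] VertexOps r V) (YW : V →ₗ[ℂ] VertexOps r W) : Prop :=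
  ∀ (u v : V) (w : W) (p q l : ℤ) (m n : Fin r → ℤ),
    (∑ᶠ i : ℕ, ((-1 : ℤ) ^ i * Ring.choose l i) •
        (YW u).coeff (p + l - i) m ((YW v).coeff (q + i) n w))
      - (∑ᶠ i : ℕ, ((l.negOnePow : ℤ) * (-1 : ℤ) ^ i * Ring.choose l i) •
        (YW v).coeff (q + l - i) n ((YW u).coeff (p + i) m w))
    = ∑ᶠ i : ℕ, Ring.choose p i • (YW ((Y u).coeff (l + i) m v)).coeff (p + q - i) (m + n) w

/-- An `(r+1)`-toroidal vertex algebra structure on the vector space `V`. -/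
structure ToroidalVertexAlgebra (r : ℕ) (V : Type*) [AddCommGroup V] [Module ℂ V] where
  /-- `Y(v; x₀, x) = ∑ v_{m₀,m} x₀^{-m₀-1} x^{-m}` -/
  Y : V →ₗ[ℂ] VertexOps r V
  /-- the vacuum vector -/
  vac : V
  /-- `Y(𝟏; x₀, x) v = v` -/
  vacuum : Y vac = oneOp r V
  /-- `Y(v; x₀, x) 𝟏 ∈ V[[x₀, x₁^{±1}, …, x_r^{±1}]]` -/
  creation : ∀ (v : V) (p : ℤ) (m : Fin r → ℤ), 0 ≤ p → (Y v).coeff p m vac = 0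
  jacobi : JacobiIdentity Y Y

/-- An extended `(r+1)`-toroidal vertex algebra structure on the vector space `V`. -/
structure ExtendedToroidalVertexAlgebra (r : ℕ) (V : Type*) [AddCommGroup V] [Module ℂ V]
    extends ToroidalVertexAlgebra r V where
  /-- the linear operators `𝓓₀, 𝓓₁, …, 𝓓_r` -/
  D : Fin (r + 1) → Module.End ℂ V
  D_vac : ∀ i : Fin (r + 1), D i vac = 0
  /-- `[𝓓_i, Y(v; x₀, x)] = Y(𝓓_i v; x₀, x)` -/
  D_comm : ∀ (i : Fin (r + 1)) (v : V) (p : ℤ) (m : Fin r → ℤ),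
    D i * (Y v).coeff p m - (Y v).coeff p m * D i = (Y (D i v)).coeff p m
  /-- `Y(𝓓₀ v; x₀, x) = ∂/∂x₀ Y(v; x₀, x)` and `Y(𝓓_j v; x₀, x) = x_j ∂/∂x_j Y(v; x₀, x)` -/
  Y_D : ∀ (i : Fin (r + 1)) (v : V), Y (D i v) = diffOp r V i (Y v)

/-- A module structure on the vector space `W` for an `(r+1)`-toroidal vertex algebra. -/
structure ToroidalModule {r : ℕ} {V : Type*} [AddCommGroup V] [Module ℂ V]
    (T : ToroidalVertexAlgebra r V) (W : Type*) [AddCommGroup W] [Module ℂ W] where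
  YW : V →ₗ[ℂ] VertexOps r W
  vacuum : YW T.vac = oneOp r W
  jacobi : JacobiIdentity T.Y YW

/-- A module is faithful if its vertex operator map is injective. -/
def ToroidalModule.IsFaithful {r : ℕ} {V : Type*} [AddCommGroup V] [Module ℂ V]
    {T : ToroidalVertexAlgebra r V} {W : Type*} [AddCommGroup W] [Module ℂ W]
    (M : ToroidalModule T W) : Prop :=
  Function.Injective M.YW

/-- The toroidal vertex algebra structure `T` on the subspace `S` of `VertexOps r W` is
`(S, Y_E, 1_W)`: all pairs in `S` are compatible, `T.Y` is `Y_E` and the vacuum is `1_W`. -/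
def IsCanonicalStructure {r : ℕ} {W : Type*} [AddCommGroup W] [Module ℂ W]
    {S : Submodule ℂ (VertexOps r W)} (T : ToroidalVertexAlgebra r S) : Prop :=
  (T.vac : VertexOps r W) = oneOp r W ∧
  ∀ a b : S, ∃ h : Compatible (a : VertexOps r W) (b : VertexOps r W),
    ∀ (m₀ : ℤ) (m : Fin r → ℤ), ((T.Y a).coeff m₀ m b : VertexOps r W) =
      comp (a : VertexOps r W) (b : VertexOps r W) h m₀ m

end Toroidal

open Toroidal

/-!
An element `a(x₀, x)` of `VertexOps r W` is a family of ordinary one-variable fields, its rows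
`∑ p, a_{p,m} x₀^{-p-1}` for fixed `m`. Mutual locality of `a` and `b` says that all pairs of rows
are local of one common order, and the operation `comp`, which is defined by the substitution
`x₀ = y₀ + z₀`, is on mutually local pairs the residue product: the row `t` of `a_{n,m} b` is the
product `f_(n) g = Res_x ((x - y)^n f(x) g(y) - (-y + x)^n g(y) f(x))` of the row `m` of `a` and the
row `t - m` of `b` (`comp_eq_resProd`). The toroidal variables are thus mere bookkeeping, and the
theorem reduces to the theory of local fields in one variable.

All formal calculus is done with coefficients. Multiplication by `(x - y)^l`, `l ∈ ℤ`, expanded in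
nonnegative powers of `y`, is the operator `binExp l`. As a family in `l` it is determined by
`(x - y)^{l+1} = (x - y)^l x - (x - y)^l y` and truncation (`eq_binExp_of_recursion`), and most
identities between expansions are proved by verifying this recursion. The same principle yields the
Jacobi identity for the action on `W`: a family `E l p q` with this recursion which vanishes for
large `l` is determined by its values at `p = 0` (`eq_finsum_of_recursion`), and for
`E l = (x - y)^l f(x) g(y) - (-y + x)^l g(y) f(x)` these are the products `f_(l) g`.

Products of local fields are local by Dong's lemma (`OneVarField.LocalOfOrder.prod`), which follows
from writing `y - z` as `(x - z) - (x - y)`. The Jacobi identity for the products themselves is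
`OneVarField.borcherds_identity`. By the principle above it amounts to locality of the operators
`Y(f; x)` and `Y(g; y)` on fields (`OneVarField.nestedDiff_eq_zero`) and to the iterate formula
(`OneVarField.nestedDiff_zero_eq`). Both are proved by weak associativity: applied to `h(z) w` and
multiplied by high powers of `x + z` and `y + z`, the operators `Y(f; x) Y(g; y)` become
`f(x + z) g(y + z)`, so the claims reduce to locality of `f` and `g`. The powers of `x + z` and
`y + z` can be cancelled, since Dong's lemma bounds the negative powers of `x` and of `y`.

Consequently every subspace of mutually local fields which contains `1_W` and is closed under the
residue products is a toroidal vertex algebra acting faithfully on `W` (`IsFieldAlgebra.toroidal`,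
`IsFieldAlgebra.module`). The span of the iterated products is such a subspace: it is local by
Dong's lemma, and the iterate formula rewrites `(a_{l,m'} c)_{n,m} y` through `a (c y)` and
`c (a y)`, which gives closedness by induction (`resProd_mem_span_iteratedProduct`). The operators
`D_i` are derivations of all products and preserve locality, and the products of `D_i a` with `b`
are multiples of products of `a` with `b`. So applying polynomials in the `D_i` preserves
locality and closedness, which gives the extended algebra (`IsFieldAlgebra.extended`).
-/

namespace Toroidal

/-! ### Binomial expansions of functions on a lattice -/

section BinomialExpansion

variable {M : Type*} [AddCommGroup M]

theorem finite_support_of_eventually_zero {φ : ℕ → M} (T : ℕ) (h : ∀ i, T ≤ i → φ i = 0) :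
    (Function.support φ).Finite :=
  (Finset.range T).finite_toSet.subset fun i hi => by
    by_contra hT
    exact hi (h i (by simpa using hT))

theorem finsum_eq_sum_range {φ : ℕ → M} (T : ℕ) (h : ∀ i, T ≤ i → φ i = 0) :
    ∑ᶠ i, φ i = ∑ i ∈ Finset.range T, φ i :=
  finsum_eq_sum_of_support_subset _ fun i hi => by
    by_contra hT
    exact hi (h i (by simpa using hT))

theorem finsum_eq_zero_add {φ : ℕ → M} (T : ℕ) (h : ∀ i, T ≤ i → φ i = 0) :
    ∑ᶠ i, φ i = φ 0 + ∑ᶠ i, φ (i + 1) := by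
  rw [finsum_eq_sum_range (T + 1) (fun i hi => h i (by omega)),
    finsum_eq_sum_range T (fun i hi => h (i + 1) (by omega)), Finset.sum_range_succ', add_comm]

/-- Pascal's rule for sums weighted by generalized binomial coefficients. -/
theorem finsum_choose_succ (l : ℤ) (φ : ℕ → M) (T : ℕ) (h : ∀ i, T ≤ i → φ i = 0) :
    ∑ᶠ i, Ring.choose (l + 1) i • φ i
      = ∑ᶠ i, Ring.choose l i • φ i + ∑ᶠ i, Ring.choose l i • φ (i + 1) := by
  rw [finsum_eq_sum_range (T + 1) (fun i hi => by rw [h i (by omega), smul_zero]),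
    finsum_eq_sum_range (T + 1) (fun i hi => by rw [h i (by omega), smul_zero]),
    finsum_eq_sum_range T (fun i hi => by rw [h (i + 1) (by omega), smul_zero]),
    Finset.sum_range_succ', Finset.sum_range_succ' (fun i => Ring.choose l i • φ i)]
  simp only [Ring.choose_succ_succ, add_smul, Finset.sum_add_distrib, Ring.choose_zero_right]
  abel

/-- A function `φ p q`, thought of as the series `∑ φ p q x^{-p-1} y^{-q-1}`, has only finitely
many negative powers of `y`, uniformly in the power of `x`. -/
def LowerTruncated (φ : ℤ → ℤ → M) : Prop := ∃ Q : ℤ, ∀ q, Q ≤ q → ∀ p, φ p q = 0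

/-- Multiplication of the series `∑ φ p q x^{-p-1} y^{-q-1}` by `(x - y)^l`, expanded in
nonnegative powers of `y`. -/
noncomputable def binExp (l : ℤ) (φ : ℤ → ℤ → M) (p q : ℤ) : M :=
  ∑ᶠ i : ℕ, ((-1 : ℤ) ^ i * Ring.choose l i) • φ (p + l - i) (q + i)

theorem LowerTruncated.eventually_zero {φ : ℤ → ℤ → M} (h : LowerTruncated φ) :
    ∃ Q : ℤ, ∀ (q : ℤ) (i : ℕ), (Q - q).toNat ≤ i → ∀ p, φ p (q + i) = 0 := by
  obtain ⟨Q, hQ⟩ := h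
  exact ⟨Q, fun q i hi p => hQ _ (by omega) p⟩

theorem LowerTruncated.finite_support {φ : ℤ → ℤ → M} (h : LowerTruncated φ) (c : ℕ → ℤ)
    (u : ℕ → ℤ) (q : ℤ) : (Function.support fun i : ℕ => c i • φ (u i) (q + i)).Finite := by
  obtain ⟨Q, hQ⟩ := h.eventually_zero
  exact finite_support_of_eventually_zero (Q - q).toNat fun i hi => by rw [hQ q i hi, smul_zero]

theorem binExp_zero (φ : ℤ → ℤ → M) (p q : ℤ) : binExp 0 φ p q = φ p q := by
  rw [binExp, finsum_eq_single _ 0]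
  · simp
  · intro i hi
    simp [Ring.choose_zero_pos ℤ (Nat.pos_of_ne_zero hi)]

theorem binExp_eq_zero {φ : ℤ → ℤ → M} {q : ℤ} (h : ∀ p (i : ℕ), φ p (q + i) = 0) (l p : ℤ) :
    binExp l φ p q = 0 :=
  finsum_eq_zero_of_forall_eq_zero fun i => by rw [h, smul_zero]

theorem binExp_congr {φ ψ : ℤ → ℤ → M} {q : ℤ} (h : ∀ p (i : ℕ), φ p (q + i) = ψ p (q + i))
    (l p : ℤ) : binExp l φ p q = binExp l ψ p q :=
  finsum_congr fun i => by rw [h]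

theorem binExp_lowerTruncated {φ : ℤ → ℤ → M} (h : LowerTruncated φ) (l : ℤ) :
    LowerTruncated (binExp l φ) := by
  obtain ⟨Q, hQ⟩ := h
  exact ⟨Q, fun q hq p => binExp_eq_zero (fun p i => hQ _ (by omega) p) l p⟩

theorem binExp_succ {φ : ℤ → ℤ → M} (h : LowerTruncated φ) (l p q : ℤ) :
    binExp (l + 1) φ p q = binExp l φ (p + 1) q - binExp l φ p (q + 1) := by
  obtain ⟨Q, hQ⟩ := h.eventually_zero
  have key := finsum_choose_succ l (fun i : ℕ => (-1 : ℤ) ^ i • φ (p + 1 + l - i) (q + i))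
    (Q - q).toNat (fun i hi => by rw [hQ q i hi, smul_zero])
  have h1 : binExp (l + 1) φ p q
      = ∑ᶠ i : ℕ, Ring.choose (l + 1) i • (-1 : ℤ) ^ i • φ (p + 1 + l - i) (q + i) :=
    finsum_congr fun i => by
      rw [smul_smul, mul_comm, show p + (l + 1) - (i : ℤ) = p + 1 + l - i by ring]
  have h2 : binExp l φ (p + 1) q
      = ∑ᶠ i : ℕ, Ring.choose l i • (-1 : ℤ) ^ i • φ (p + 1 + l - i) (q + i) :=
    finsum_congr fun i => by rw [smul_smul, mul_comm]
  have h3 : binExp l φ p (q + 1)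
      = -∑ᶠ i : ℕ, Ring.choose l i • (-1 : ℤ) ^ (i + 1) •
          φ (p + 1 + l - (i + 1 : ℕ)) (q + (i + 1 : ℕ)) := by
    rw [← finsum_neg_distrib]
    refine finsum_congr fun i => ?_
    rw [smul_smul, ← neg_smul, Nat.cast_add, Nat.cast_one,
      show p + 1 + l - ((i : ℤ) + 1) = p + l - i by ring,
      show q + ((i : ℤ) + 1) = q + 1 + i by ring]
    congr 1
    ring
  rw [h1, h2, h3, key]
  abel

/-- Multiplication by `x - y` is injective on series which are truncated below in `y`. -/
theorem eq_of_sub_shift_eq {φ ψ : ℤ → ℤ → M} (hφ : LowerTruncated φ) (hψ : LowerTruncated ψ)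
    (h : ∀ p q, φ (p + 1) q - φ p (q + 1) = ψ (p + 1) q - ψ p (q + 1)) (p q : ℤ) :
    φ p q = ψ p q := by
  obtain ⟨Q, hQ⟩ := hφ
  obtain ⟨R, hR⟩ := hψ
  have key : ∀ n : ℕ, ∀ p q, Q ⊔ R ≤ q + n → φ p q = ψ p q := by
    intro n
    induction n with
    | zero =>
      intro p q hq
      rw [hQ q (le_trans le_sup_left (by simpa using hq)),
        hR q (le_trans le_sup_right (by simpa using hq))]
    | succ n ih =>
      intro p q hq
      have := h (p - 1) q
      rw [ih (p - 1) (q + 1) (by push_cast at hq; linarith), sub_add_cancel] at this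
      exact sub_left_injective this
  exact key (Q ⊔ R - q).toNat p q (by omega)

/-- The binomial expansions `(x - y)^l φ`, `l ∈ ℤ`, are determined by the recursion in `l` and by
truncation. -/
theorem eq_binExp_of_recursion {L : ℤ → ℤ → ℤ → M}
    (hL : ∀ l p q, L (l + 1) p q = L l (p + 1) q - L l p (q + 1))
    (hT : ∀ l, LowerTruncated (L l)) (l p q : ℤ) : L l p q = binExp l (L 0) p q := by
  induction l using Int.induction_on generalizing p q with
  | zero => rw [binExp_zero]
  | succ l ih => rw [hL, ih, ih, binExp_succ (hT 0)]
  | pred l ih =>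
    refine eq_of_sub_shift_eq (hT _) (binExp_lowerTruncated (hT 0) _) (fun p q => ?_) p q
    rw [← hL, ← binExp_succ (hT 0), sub_add_cancel, ih]

theorem LowerTruncated.add {φ ψ : ℤ → ℤ → M} (hφ : LowerTruncated φ) (hψ : LowerTruncated ψ) :
    LowerTruncated fun p q => φ p q + ψ p q := by
  obtain ⟨Q, hQ⟩ := hφ
  obtain ⟨R, hR⟩ := hψ
  exact ⟨Q ⊔ R, fun q hq p => by
    beta_reduce
    rw [hQ q (le_trans le_sup_left hq), hR q (le_trans le_sup_right hq), add_zero]⟩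

theorem LowerTruncated.map {N : Type*} [AddCommGroup N] {φ : ℤ → ℤ → M} (hφ : LowerTruncated φ)
    (g : M →+ N) : LowerTruncated fun p q => g (φ p q) := by
  obtain ⟨Q, hQ⟩ := hφ
  exact ⟨Q, fun q hq p => by beta_reduce; rw [hQ q hq, map_zero]⟩

theorem LowerTruncated.shift {φ : ℤ → ℤ → M} (hφ : LowerTruncated φ) (a b : ℤ) :
    LowerTruncated fun p q => φ (p + a) (q + b) := by
  obtain ⟨Q, hQ⟩ := hφ
  exact ⟨Q - b, fun q hq p => hQ _ (by omega) _⟩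

theorem binExp_add {φ ψ : ℤ → ℤ → M} (hφ : LowerTruncated φ) (hψ : LowerTruncated ψ)
    (l p q : ℤ) :
    binExp l (fun p q => φ p q + ψ p q) p q = binExp l φ p q + binExp l ψ p q := by
  unfold binExp
  rw [← finsum_add_distrib (hφ.finite_support _ _ _) (hψ.finite_support _ _ _)]
  exact finsum_congr fun i => smul_add _ _ _

theorem map_binExp {N : Type*} [AddCommGroup N] {φ : ℤ → ℤ → M} (hφ : LowerTruncated φ)
    (g : M →+ N) (l p q : ℤ) :
    g (binExp l φ p q) = binExp l (fun p q => g (φ p q)) p q := by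
  unfold binExp
  rw [AddMonoidHom.map_finsum g (hφ.finite_support _ _ _)]
  exact finsum_congr fun i => map_zsmul _ _ _

theorem binExp_sub {φ ψ : ℤ → ℤ → M} (hφ : LowerTruncated φ) (hψ : LowerTruncated ψ)
    (l p q : ℤ) :
    binExp l (fun p q => φ p q - ψ p q) p q = binExp l φ p q - binExp l ψ p q := by
  have h := binExp_add hφ (hψ.map (-AddMonoidHom.id M)) l p q
  rw [← map_binExp hψ (-AddMonoidHom.id M)] at h
  simpa [sub_eq_add_neg] using h

theorem binExp_sub_zsmul {φ ψ : ℤ → ℤ → M} (hφ : LowerTruncated φ) (hψ : LowerTruncated ψ)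
    (c l p q : ℤ) :
    binExp l (fun p q => φ p q - c • ψ p q) p q = binExp l φ p q - c • binExp l ψ p q := by
  have hcψ : LowerTruncated fun p q => c • ψ p q := hψ.map (DistribSMul.toAddMonoidHom M c)
  rw [binExp_sub hφ hcψ]
  exact congrArg _ (map_binExp hψ (DistribSMul.toAddMonoidHom M c) l p q).symm

theorem binExp_shift (φ : ℤ → ℤ → M) (a b l p q : ℤ) :
    binExp l (fun p q => φ (p + a) (q + b)) p q = binExp l φ (p + a) (q + b) :=
  finsum_congr fun i => by
    beta_reduce
    rw [show p + l - (i : ℤ) + a = p + a + l - i by ring,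
      show q + (i : ℤ) + b = q + b + i by ring]

/-- `(x - y)^l φ - (-y + x)^l ψ`, the first binomial expanded in nonnegative powers of `y` and the
second one in nonnegative powers of `x`. The variable `y` comes first in `ψ`. -/
noncomputable def borcherdsDiff (φ ψ : ℤ → ℤ → M) (l p q : ℤ) : M :=
  binExp l φ p q - (l.negOnePow : ℤ) • binExp l ψ q p

theorem borcherdsDiff_succ {φ ψ : ℤ → ℤ → M} (hφ : LowerTruncated φ) (hψ : LowerTruncated ψ)
    (l p q : ℤ) :
    borcherdsDiff φ ψ (l + 1) p q
      = borcherdsDiff φ ψ l (p + 1) q - borcherdsDiff φ ψ l p (q + 1) := by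
  unfold borcherdsDiff
  rw [binExp_succ hφ, binExp_succ hψ, Int.negOnePow_succ, Units.val_neg, neg_smul, smul_sub]
  abel

theorem map_borcherdsDiff {N : Type*} [AddCommGroup N] {φ ψ : ℤ → ℤ → M} (hφ : LowerTruncated φ)
    (hψ : LowerTruncated ψ) (g : M →+ N) (l p q : ℤ) :
    g (borcherdsDiff φ ψ l p q)
      = borcherdsDiff (fun p q => g (φ p q)) (fun q p => g (ψ q p)) l p q := by
  simp only [borcherdsDiff, map_sub, map_zsmul, map_binExp hφ, map_binExp hψ]

theorem borcherdsDiff_add {φ ψ φ' ψ' : ℤ → ℤ → M} (hφ : LowerTruncated φ)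
    (hψ : LowerTruncated ψ) (hφ' : LowerTruncated φ') (hψ' : LowerTruncated ψ') (l p q : ℤ) :
    borcherdsDiff (fun p q => φ p q + φ' p q) (fun q p => ψ q p + ψ' q p) l p q
      = borcherdsDiff φ ψ l p q + borcherdsDiff φ' ψ' l p q := by
  simp only [borcherdsDiff, binExp_add hφ hφ', binExp_add hψ hψ', smul_add]
  abel

theorem borcherdsDiff_eq_zero_of_le {E : ℤ → ℤ → ℤ → M}
    (hE : ∀ l p q, E (l + 1) p q = E l (p + 1) q - E l p (q + 1)) {k l : ℤ} (hkl : k ≤ l)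
    (hk : ∀ p q, E k p q = 0) (p q : ℤ) : E l p q = 0 := by
  induction l, hkl using Int.leInduction generalizing p q with
  | base => exact hk p q
  | succ l _ ih => rw [hE, ih, ih, sub_zero]

/-- A family obeying the recursion of `(x - y)^l` and vanishing for large `l` is determined by its
values at `p = 0`: this is the passage from the iterate formula to the Borcherds identity. -/
theorem eq_finsum_of_recursion {E : ℤ → ℤ → ℤ → M}
    (hE : ∀ l p q, E (l + 1) p q = E l (p + 1) q - E l p (q + 1)) {k : ℤ}
    (hk : ∀ p q, E k p q = 0) (l p q : ℤ) :
    E l p q = ∑ᶠ i : ℕ, Ring.choose p i • E (l + i) 0 (p + q - i) := by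
  have hk' : ∀ l, k ≤ l → ∀ p q, E l p q = 0 := fun l hl => borcherdsDiff_eq_zero_of_le hE hl hk
  -- the right side obeys the recursion of `E`
  have pascal : ∀ l p q, ∑ᶠ i : ℕ, Ring.choose (p + 1) i • E (l + i) 0 (p + 1 + q - i)
      = ∑ᶠ i : ℕ, Ring.choose p i • E (l + i) 0 (p + (q + 1) - i)
        + ∑ᶠ i : ℕ, Ring.choose p i • E (l + 1 + i) 0 (p + q - i) := by
    intro l p q
    rw [finsum_choose_succ p (fun i : ℕ => E (l + i) 0 (p + 1 + q - i)) (k - l).toNat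
      (fun i hi => hk' _ (by omega) _ _)]
    congr 1 <;> refine finsum_congr fun i => ?_
    · rw [show p + 1 + q - (i : ℤ) = p + (q + 1) - i by ring]
    · rw [Nat.cast_add, Nat.cast_one, show l + ((i : ℤ) + 1) = l + 1 + i by ring,
        show p + 1 + q - ((i : ℤ) + 1) = p + q - i by ring]
  have zero : ∀ l q, E l 0 q = ∑ᶠ i : ℕ, Ring.choose (0 : ℤ) i • E (l + i) 0 (0 + q - i) := by
    intro l q
    rw [finsum_eq_single _ 0]
    · simp
    · intro i hi
      rw [Ring.choose_zero_pos ℤ (Nat.pos_of_ne_zero hi), zero_smul]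
  -- descending induction on `l`: by the recursion, if the two sides agree for `l + 1`, then their
  -- difference for `l` depends on `p + q` only, so it is enough to compare them at `p = 0`
  have main : ∀ n : ℕ, ∀ l, k ≤ l + n → ∀ p q,
      E l p q = ∑ᶠ i : ℕ, Ring.choose p i • E (l + i) 0 (p + q - i) := by
    intro n
    induction n with
    | zero =>
      intro l hl p q
      rw [hk' l (by simpa using hl), finsum_eq_zero_of_forall_eq_zero]
      intro i
      rw [hk' (l + i) (by simp at hl; omega), smul_zero]
    | succ n ih =>
      intro l hl p
      have ih' := ih (l + 1) (by push_cast at hl; linarith)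
      induction p using Int.induction_on with
      | zero => exact zero l
      | succ p ihp =>
        intro q
        rw [pascal, ← ihp, ← ih', hE]
        abel
      | pred p ihp =>
        intro q
        have h1 := ihp (q - 1)
        have h2 := pascal l (-(p : ℤ) - 1) (q - 1)
        have h3 := hE l (-(p : ℤ) - 1) (q - 1)
        rw [sub_add_cancel] at h2 h3
        rw [← ih', sub_add_cancel, ← h1] at h2
        rw [h3, sub_add_cancel] at h2
        rw [← add_sub_assoc, eq_sub_iff_add_eq, add_comm _ (E l (-(p : ℤ)) (q - 1))] at h2
        exact add_left_cancel h2
  exact main (k - l).toNat l (by omega) p q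

end BinomialExpansion

/-! ### Operators on functions of three lattice variables -/

section ThreeVariables

variable {W : Type*} [AddCommGroup W]

/-- The endomorphisms of the group of functions of three lattice variables. -/
abbrev TripleEnd (W : Type*) [AddCommGroup W] : Type _ := Module.End ℤ (ℤ → ℤ → ℤ → W)

/-- Shift of the first variable: multiplication by `x` on series
`∑ G p q s x^{-p-1} y^{-q-1} z^{-s-1}`. -/
def shiftX : TripleEnd W where
  toFun G p q s := G (p + 1) q s
  map_add' _ _ := rfl
  map_smul' _ _ := rfl

/-- Shift of the second variable: multiplication by `y`. -/
def shiftY : TripleEnd W where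
  toFun G p q s := G p (q + 1) s
  map_add' _ _ := rfl
  map_smul' _ _ := rfl

/-- Shift of the third variable: multiplication by `z`. -/
def shiftZ : TripleEnd W where
  toFun G p q s := G p q (s + 1)
  map_add' _ _ := rfl
  map_smul' _ _ := rfl

/-- Exchange of the first two variables. -/
def swapXY : TripleEnd W where
  toFun G p q s := G q p s
  map_add' _ _ := rfl
  map_smul' _ _ := rfl

theorem commute_shiftX_shiftY : Commute (shiftX (W := W)) shiftY := rfl

theorem commute_shiftX_shiftZ : Commute (shiftX (W := W)) shiftZ := rfl

theorem commute_shiftY_shiftZ : Commute (shiftY (W := W)) shiftZ := rfl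

theorem commute_XZ_YZ : Commute (shiftX - shiftZ : TripleEnd W) (shiftY - shiftZ) :=
  (commute_shiftX_shiftY.sub_right commute_shiftX_shiftZ).sub_left
    (commute_shiftY_shiftZ.symm.sub_right (Commute.refl _))

theorem commute_XY_YZ : Commute (shiftX - shiftY : TripleEnd W) (shiftY - shiftZ) :=
  (commute_shiftX_shiftY.sub_right commute_shiftX_shiftZ).sub_left
    ((Commute.refl _).sub_right commute_shiftY_shiftZ)

theorem commute_XZ_XY : Commute (shiftX - shiftZ : TripleEnd W) (shiftX - shiftY) :=
  ((Commute.refl _).sub_right commute_shiftX_shiftY).sub_left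
    (commute_shiftX_shiftZ.symm.sub_right commute_shiftY_shiftZ.symm)

theorem shiftY_sub_pow_apply {D : ℤ → ℤ → ℤ → W} {p : ℤ} {E : ℤ → ℤ → ℤ → W}
    (hE : ∀ l q s, E (l + 1) q s = E l (q + 1) s - E l q (s + 1))
    (h0 : ∀ q s, E 0 q s = D p q s) (l : ℕ) (q s : ℤ) :
    ((shiftY - shiftZ) ^ l : TripleEnd W) D p q s = E l q s := by
  induction l generalizing q s with
  | zero => exact (h0 q s).symm
  | succ l ih =>
    rw [pow_succ', Nat.cast_succ, hE, ← ih, ← ih]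
    rfl

theorem shiftX_sub_pow_apply {D : ℤ → ℤ → ℤ → W} {q : ℤ} {E : ℤ → ℤ → ℤ → W}
    (hE : ∀ l p s, E (l + 1) p s = E l (p + 1) s - E l p (s + 1))
    (h0 : ∀ p s, E 0 p s = D p q s) (l : ℕ) (p s : ℤ) :
    ((shiftX - shiftZ) ^ l : TripleEnd W) D p q s = E l p s := by
  induction l generalizing p s with
  | zero => exact (h0 p s).symm
  | succ l ih =>
    rw [pow_succ', Nat.cast_succ, hE, ← ih, ← ih]
    rfl

theorem shiftY_add_pow_apply {D : ℤ → ℤ → ℤ → W} {p : ℤ} {E : ℕ → ℤ → ℤ → W}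
    (hE : ∀ b q s, E (b + 1) q s = E b (q + 1) s + E b q (s + 1))
    (h0 : ∀ q s, E 0 q s = D p q s) (b : ℕ) (q s : ℤ) :
    ((shiftY + shiftZ) ^ b : TripleEnd W) D p q s = E b q s := by
  induction b generalizing q s with
  | zero => exact (h0 q s).symm
  | succ l ih =>
    rw [pow_succ', hE, ← ih, ← ih]
    rfl

theorem shiftX_add_pow_apply {D : ℤ → ℤ → ℤ → W} {q : ℤ} {E : ℕ → ℤ → ℤ → W}
    (hE : ∀ a p s, E (a + 1) p s = E a (p + 1) s + E a p (s + 1))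
    (h0 : ∀ p s, E 0 p s = D p q s) (a : ℕ) (p s : ℤ) :
    ((shiftX + shiftZ) ^ a : TripleEnd W) D p q s = E a p s := by
  induction a generalizing p s with
  | zero => exact (h0 p s).symm
  | succ l ih =>
    rw [pow_succ', hE, ← ih, ← ih]
    rfl

/-- Multiplication by `y + z` is injective on series truncated below in `y`. -/
theorem eq_zero_of_shiftY_add_pow {D : ℤ → ℤ → ℤ → W} {p Q : ℤ}
    (hQ : ∀ q, Q ≤ q → ∀ s, D p q s = 0) (b : ℕ)
    (h : ∀ q s, ((shiftY + shiftZ) ^ b : TripleEnd W) D p q s = 0) (q s : ℤ) : D p q s = 0 := by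
  induction b generalizing D q s with
  | zero => exact h q s
  | succ b ih =>
    have h1 : ∀ q s, D p (q + 1) s + D p q (s + 1) = 0 := fun q s => by
      refine ih (D := (shiftY + shiftZ : TripleEnd W) D) (fun q hq s => ?_) (fun q s => ?_) q s
      · change D p (q + 1) s + D p q (s + 1) = 0
        rw [hQ _ (by omega), hQ _ hq, add_zero]
      · have := h q s
        rwa [pow_succ] at this
    have key : ∀ n : ℕ, ∀ q s, Q ≤ q + n → D p q s = 0 := by
      intro n
      induction n with
      | zero => exact fun q s hq => hQ q (by simpa using hq) s
      | succ n ihn =>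
        intro q s hq
        have := h1 q (s - 1)
        rwa [ihn (q + 1) _ (by push_cast at hq; linarith), zero_add, sub_add_cancel] at this
    exact key (Q - q).toNat q s (by omega)

/-- Multiplication by `x + z` is injective on series truncated below in `x`. -/
theorem eq_zero_of_shiftX_add_pow {D : ℤ → ℤ → ℤ → W} {q P : ℤ}
    (hP : ∀ p, P ≤ p → ∀ s, D p q s = 0) (a : ℕ)
    (h : ∀ p s, ((shiftX + shiftZ) ^ a : TripleEnd W) D p q s = 0) (p s : ℤ) : D p q s = 0 := by
  have hswap : SemiconjBy (swapXY : TripleEnd W) (shiftX + shiftZ) (shiftY + shiftZ) := rfl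
  refine eq_zero_of_shiftY_add_pow (D := (swapXY : TripleEnd W) D) (p := q) hP a (fun p s => ?_) p s
  have := LinearMap.congr_fun (hswap.pow_right a) D
  exact (congr_fun (congr_fun (congr_fun this q) p) s).symm.trans (h p s)

theorem shiftY_add_pow_slice_congr {D D' : ℤ → ℤ → ℤ → W} {p p' : ℤ}
    (h : ∀ q s, D p q s = D' p' q s) (b : ℕ) (q s : ℤ) :
    ((shiftY + shiftZ) ^ b : TripleEnd W) D p q s
      = ((shiftY + shiftZ) ^ b : TripleEnd W) D' p' q s :=
  shiftY_add_pow_apply (E := fun b q s => ((shiftY + shiftZ) ^ b : TripleEnd W) D' p' q s)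
    (fun b q s => by rw [pow_succ']; rfl) (fun q s => (h q s).symm) b q s

/-- On families vanishing above `l`, multiplication by `u + y + z` is multiplication by `y + z` in
degree `l` of the variable `u`. -/
theorem shift_pow_apply_of_vanishing {D : ℤ → ℤ → ℤ → W} {l : ℤ}
    (hD : ∀ l', l < l' → ∀ q s, D l' q s = 0) (a : ℕ) {l' : ℤ} (hl' : l ≤ l') (q s : ℤ) :
    ((shiftX + (shiftY + shiftZ)) ^ a : TripleEnd W) D l' q s
      = ((shiftY + shiftZ) ^ a : TripleEnd W) D l' q s := by
  induction a generalizing l' q s with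
  | zero => rfl
  | succ a ih =>
    have h0 : ((shiftY + shiftZ) ^ a : TripleEnd W) D (l' + 1) q s = 0 :=
      (shiftY_add_pow_slice_congr (D' := 0) (p' := 0) (hD (l' + 1) (by omega)) a q s).trans
        (by rw [map_zero]; rfl)
    rw [pow_succ', pow_succ', Module.End.mul_apply, Module.End.mul_apply]
    exact (congrArg₂ (· + ·) ((ih (l' := l' + 1) (by omega) q s).trans h0)
      (congrArg₂ (· + ·) (ih hl' (q + 1) s) (ih hl' q (s + 1)))).trans (zero_add _)

/-- On functions of `l, p, q, s` which are annihilated by `u - (x - y)`, where `u` is the shift of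
`l`, multiplication by `x + z` is multiplication by `u + y + z`. -/
theorem shiftX_add_pow_of_recursion {E : ℤ → ℤ → ℤ → ℤ → W}
    (hE : ∀ l p q s, E (l + 1) p q s = E l (p + 1) q s - E l p (q + 1) s) (a : ℕ) (l p q s : ℤ) :
    ((shiftX + shiftZ) ^ a : TripleEnd W) (E l) p q s
      = ((shiftX + (shiftY + shiftZ)) ^ a : TripleEnd W) (fun l q s => E l p q s) l q s := by
  induction a generalizing E with
  | zero => rfl
  | succ a ih =>
    rw [pow_succ, pow_succ, Module.End.mul_apply, Module.End.mul_apply]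
    refine (ih (E := fun l => (shiftX + shiftZ : TripleEnd W) (E l)) ?_).trans ?_
    · intro l p q s
      change E (l + 1) (p + 1) q s + E (l + 1) p q (s + 1)
        = (E l (p + 1 + 1) q s + E l (p + 1) q (s + 1)) -
          (E l (p + 1) (q + 1) s + E l p (q + 1) (s + 1))
      rw [hE, hE]
      abel
    · have : (fun l q s => (shiftX + shiftZ : TripleEnd W) (E l) p q s)
          = (shiftX + (shiftY + shiftZ) : TripleEnd W) (fun l q s => E l p q s) := by
        funext l q s
        change E l (p + 1) q s + E l p q (s + 1)
          = E (l + 1) p q s + (E l p (q + 1) s + E l p q (s + 1))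
        rw [hE]
        abel
      rw [this]

/-- Multiplication by `(x - y)^l`, expanded in nonnegative powers of `y`. -/
noncomputable def expXY (l : ℤ) (G : ℤ → ℤ → ℤ → W) : ℤ → ℤ → ℤ → W :=
  fun p q s => binExp l (fun p q => G p q s) p q

/-- Multiplication by `(x - z)^l`, expanded in nonnegative powers of `z`. -/
noncomputable def expXZ (l : ℤ) (G : ℤ → ℤ → ℤ → W) : ℤ → ℤ → ℤ → W :=
  fun p q s => binExp l (fun p s => G p q s) p s

/-- Multiplication by `(y - z)^l`, expanded in nonnegative powers of `z`. -/
noncomputable def expYZ (l : ℤ) (G : ℤ → ℤ → ℤ → W) : ℤ → ℤ → ℤ → W :=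
  fun p q s => binExp l (fun q s => G p q s) q s

theorem expXY_zero (G : ℤ → ℤ → ℤ → W) : expXY 0 G = G := by
  funext p q s
  exact binExp_zero _ _ _

/-- Operators which commute with all the expansions `expXY l`, on series truncated in `y`. -/
def CommutesWithExpXY (O : TripleEnd W) : Prop :=
  ∀ G : ℤ → ℤ → ℤ → W, (∀ s, LowerTruncated fun p q => G p q s) →
    (∀ s, LowerTruncated fun p q => O G p q s) ∧ ∀ l, expXY l (O G) = O (expXY l G)

theorem commutesWithExpXY_shiftX : CommutesWithExpXY (shiftX (W := W)) := by
  refine fun G hG => ⟨fun s => ?_, fun l => ?_⟩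
  · have h := (hG s).shift 1 0
    simp only [add_zero] at h
    exact h
  · funext p q s
    have h := binExp_shift (fun p q => G p q s) 1 0 l p q
    simp only [add_zero] at h
    exact h

theorem commutesWithExpXY_shiftY : CommutesWithExpXY (shiftY (W := W)) := by
  refine fun G hG => ⟨fun s => ?_, fun l => ?_⟩
  · have h := (hG s).shift 0 1
    simp only [add_zero] at h
    exact h
  · funext p q s
    have h := binExp_shift (fun p q => G p q s) 0 1 l p q
    simp only [add_zero] at h
    exact h

theorem commutesWithExpXY_shiftZ : CommutesWithExpXY (shiftZ (W := W)) :=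
  fun _ hG => ⟨fun s => hG (s + 1), fun _ => rfl⟩

theorem CommutesWithExpXY.add {O O' : TripleEnd W} (hO : CommutesWithExpXY O)
    (hO' : CommutesWithExpXY O') : CommutesWithExpXY (O + O') := by
  intro G hG
  refine ⟨fun s => ((hO G hG).1 s).add ((hO' G hG).1 s), fun l => ?_⟩
  rw [LinearMap.add_apply, LinearMap.add_apply, ← (hO G hG).2, ← (hO' G hG).2]
  funext p q s
  exact binExp_add ((hO G hG).1 s) ((hO' G hG).1 s) l p q

theorem CommutesWithExpXY.sub {O O' : TripleEnd W} (hO : CommutesWithExpXY O)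
    (hO' : CommutesWithExpXY O') : CommutesWithExpXY (O - O') := by
  intro G hG
  refine ⟨fun s => ?_, fun l => ?_⟩
  · have := ((hO G hG).1 s).add (((hO' G hG).1 s).map (-AddMonoidHom.id W))
    simpa [sub_eq_add_neg] using this
  rw [LinearMap.sub_apply, LinearMap.sub_apply, ← (hO G hG).2, ← (hO' G hG).2]
  funext p q s
  exact binExp_sub ((hO G hG).1 s) ((hO' G hG).1 s) l p q

theorem CommutesWithExpXY.mul {O O' : TripleEnd W} (hO : CommutesWithExpXY O)
    (hO' : CommutesWithExpXY O') : CommutesWithExpXY (O * O') := by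
  intro G hG
  refine ⟨(hO _ (hO' G hG).1).1, fun l => ?_⟩
  rw [Module.End.mul_apply, (hO _ (hO' G hG).1).2, (hO' G hG).2, Module.End.mul_apply]

theorem CommutesWithExpXY.pow {O : TripleEnd W} (hO : CommutesWithExpXY O)
    (n : ℕ) : CommutesWithExpXY (O ^ n) := by
  induction n with
  | zero => exact fun G hG => ⟨hG, fun _ => rfl⟩
  | succ n ih => rw [pow_succ]; exact ih.mul hO

/-- Series `∑ G p q s x^{-p-1} y^{-q-1} z^{-s-1}` in the domain `|x| > |y| > |z|`: the negative
powers of `z` are bounded, and those of `y` are bounded as soon as those of `z` are bounded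
above. -/
structure IteratedLaurent (G : ℤ → ℤ → ℤ → W) : Prop where
  truncZ : ∃ S : ℤ, ∀ s, S ≤ s → ∀ p q, G p q s = 0
  truncY : ∀ s₀ : ℤ, ∃ Q : ℤ, ∀ s, s₀ ≤ s → ∀ q, Q ≤ q → ∀ p, G p q s = 0

theorem expXZ_expYZ {G : ℤ → ℤ → ℤ → W}
    (hG : ∃ S : ℤ, ∀ s, S ≤ s → ∀ p q, G p q s = 0) (k l : ℤ) :
    expXZ k (expYZ l G) = expYZ l (expXZ k G) := by
  obtain ⟨S, hS⟩ := hG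
  funext p q s
  have e1 : ∀ p s', s ≤ s' → expYZ l G p q s'
      = ∑ j ∈ Finset.range (S - s).toNat,
        ((-1 : ℤ) ^ j * Ring.choose l j) • G p (q + l - j) (s' + j) :=
    fun p s' hs => finsum_eq_sum_range _ fun j hj => by
      dsimp only
      rw [hS _ (by omega), smul_zero]
  have e2 : ∀ q s', s ≤ s' → expXZ k G p q s'
      = ∑ i ∈ Finset.range (S - s).toNat,
        ((-1 : ℤ) ^ i * Ring.choose k i) • G (p + k - i) q (s' + i) :=
    fun p s' hs => finsum_eq_sum_range _ fun j hj => by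
      dsimp only
      rw [hS _ (by omega), smul_zero]
  have h1 : expXZ k (expYZ l G) p q s
      = ∑ i ∈ Finset.range (S - s).toNat, ((-1 : ℤ) ^ i * Ring.choose k i) •
        expYZ l G (p + k - i) q (s + i) :=
    finsum_eq_sum_range _ fun i hi => by
      dsimp only
      rw [show expYZ l G (p + k - i) q (s + i) = 0 from
        binExp_eq_zero (fun q j => hS _ (by omega) _ _) l q, smul_zero]
  have h2 : expYZ l (expXZ k G) p q s
      = ∑ j ∈ Finset.range (S - s).toNat, ((-1 : ℤ) ^ j * Ring.choose l j) •
        expXZ k G p (q + l - j) (s + j) :=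
    finsum_eq_sum_range _ fun j hj => by
      dsimp only
      rw [show expXZ k G p (q + l - j) (s + j) = 0 from
        binExp_eq_zero (fun p i => hS _ (by omega) _ _) k p, smul_zero]
  have e1' : ∀ (p : ℤ) (i : ℕ), _ := fun p i => e1 p (s + i) (by omega)
  have e2' : ∀ (q : ℤ) (i : ℕ), _ := fun q i => e2 q (s + i) (by omega)
  rw [h1, h2]
  simp only [e1', e2', Finset.smul_sum]
  rw [Finset.sum_comm]
  refine Finset.sum_congr rfl fun i _ => Finset.sum_congr rfl fun j _ => ?_
  rw [smul_comm, add_right_comm]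

namespace IteratedLaurent

variable {G : ℤ → ℤ → ℤ → W}

theorem lowerTruncated_XY (hG : IteratedLaurent G) (s : ℤ) :
    LowerTruncated fun p q => G p q s := by
  obtain ⟨Q, hQ⟩ := hG.truncY s
  exact ⟨Q, hQ s le_rfl⟩

theorem lowerTruncated_XZ (hG : IteratedLaurent G) (q : ℤ) :
    LowerTruncated fun p s => G p q s := by
  obtain ⟨S, hS⟩ := hG.truncZ
  exact ⟨S, fun s hs p => hS s hs p q⟩

theorem lowerTruncated_YZ (hG : IteratedLaurent G) (p : ℤ) :
    LowerTruncated fun q s => G p q s := by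
  obtain ⟨S, hS⟩ := hG.truncZ
  exact ⟨S, fun s hs q => hS s hs p q⟩

theorem expXY (hG : IteratedLaurent G) (l : ℤ) : IteratedLaurent (expXY l G) := by
  refine ⟨?_, fun s₀ => ?_⟩
  · obtain ⟨S, hS⟩ := hG.truncZ
    exact ⟨S, fun s hs p q => binExp_eq_zero (fun p i => hS s hs p _) l p⟩
  · obtain ⟨Q, hQ⟩ := hG.truncY s₀
    exact ⟨Q, fun s hs q hq p => binExp_eq_zero (fun p i => hQ s hs _ (by omega) p) l p⟩

theorem expXZ (hG : IteratedLaurent G) (l : ℤ) : IteratedLaurent (expXZ l G) := by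
  refine ⟨?_, fun s₀ => ?_⟩
  · obtain ⟨S, hS⟩ := hG.truncZ
    exact ⟨S, fun s hs p q => binExp_eq_zero (fun p i => hS _ (by omega) p _) l p⟩
  · obtain ⟨Q, hQ⟩ := hG.truncY s₀
    exact ⟨Q, fun s hs q hq p => binExp_eq_zero (fun p i => hQ _ (by omega) _ hq p) l p⟩

theorem exists_expYZ_eq_zero (hG : IteratedLaurent G) (s₀ : ℤ) :
    ∃ Q : ℤ, ∀ l p q s, s₀ ≤ s → Q ≤ q + l → Toroidal.expYZ l G p q s = 0 := by
  obtain ⟨S, hS⟩ := hG.truncZ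
  obtain ⟨Q, hQ⟩ := hG.truncY s₀
  refine ⟨Q + (S - s₀).toNat, fun l p q s hs hq => finsum_eq_zero_of_forall_eq_zero fun i => ?_⟩
  dsimp only
  by_cases hi : S ≤ s + i
  · rw [hS _ hi, smul_zero]
  · rw [hQ _ (by omega) _ (by omega), smul_zero]

theorem expYZ (hG : IteratedLaurent G) (l : ℤ) : IteratedLaurent (expYZ l G) := by
  refine ⟨?_, fun s₀ => ?_⟩
  · obtain ⟨S, hS⟩ := hG.truncZ
    exact ⟨S, fun s hs p q => binExp_eq_zero (fun q i => hS _ (by omega) p _) l q⟩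
  · obtain ⟨Q, hQ⟩ := hG.exists_expYZ_eq_zero s₀
    exact ⟨Q - l, fun s hs q hq p => hQ l p q s hs (by omega)⟩

theorem exists_expXZ_expYZ_eq_zero (hG : IteratedLaurent G) (s : ℤ) :
    ∃ Q : ℤ, ∀ k l p q, Q ≤ q + l →
      Toroidal.expXZ k (Toroidal.expYZ l G) p q s = 0 := by
  obtain ⟨Q, hQ⟩ := hG.exists_expYZ_eq_zero s
  exact ⟨Q, fun k l p q hq => binExp_eq_zero (fun p i => hQ l p q _ (by omega) hq) k p⟩

theorem expXY_expYZ (hG : IteratedLaurent G) (l k : ℤ) :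
    Toroidal.expXY l (Toroidal.expYZ k G) = Toroidal.expYZ k (Toroidal.expXY l G) := by
  funext p q s
  have hrec : ∀ l p q, Toroidal.expYZ k (Toroidal.expXY (l + 1) G) p q s
      = Toroidal.expYZ k (Toroidal.expXY l G) (p + 1) q s
        - Toroidal.expYZ k (Toroidal.expXY l G) p (q + 1) s := by
    intro l p q
    have h1 := (hG.expXY l).lowerTruncated_YZ (p + 1)
    have h2 : LowerTruncated fun q s => Toroidal.expXY l G p (q + 1) s := by
      simpa using ((hG.expXY l).lowerTruncated_YZ p).shift 1 0
    have h3 := binExp_shift (fun q s => Toroidal.expXY l G p q s) 1 0 k q s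
    simp only [add_zero] at h3
    change binExp k _ q s = binExp k _ q s - binExp k _ (q + 1) s
    rw [← h3, ← binExp_sub h1 h2]
    exact binExp_congr (fun q i => binExp_succ (hG.lowerTruncated_XY _) l p q) k q
  have h := eq_binExp_of_recursion
    (L := fun l p q => Toroidal.expYZ k (Toroidal.expXY l G) p q s) hrec
    (fun l => ((hG.expXY l).expYZ k).lowerTruncated_XY s) l p q
  simp only [expXY_zero] at h
  exact h.symm

theorem expXY_expXZ (hG : IteratedLaurent G) (l k : ℤ) :
    Toroidal.expXY l (Toroidal.expXZ k G) = Toroidal.expXZ k (Toroidal.expXY l G) := by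
  funext p q s
  have hrec : ∀ l p q, Toroidal.expXZ k (Toroidal.expXY (l + 1) G) p q s
      = Toroidal.expXZ k (Toroidal.expXY l G) (p + 1) q s
        - Toroidal.expXZ k (Toroidal.expXY l G) p (q + 1) s := by
    intro l p q
    have h1 := (hG.expXY l).lowerTruncated_XZ (q + 1)
    have h2 : LowerTruncated fun p s => Toroidal.expXY l G (p + 1) q s := by
      simpa using ((hG.expXY l).lowerTruncated_XZ q).shift 1 0
    have h3 := binExp_shift (fun p s => Toroidal.expXY l G p q s) 1 0 k p s
    simp only [add_zero] at h3
    change binExp k _ p s = binExp k _ (p + 1) s - binExp k _ p s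
    rw [← h3, ← binExp_sub h2 h1]
    exact binExp_congr (fun p i => binExp_succ (hG.lowerTruncated_XY _) l p q) k p
  have h := eq_binExp_of_recursion
    (L := fun l p q => Toroidal.expXZ k (Toroidal.expXY l G) p q s) hrec
    (fun l => ((hG.expXY l).expXZ k).lowerTruncated_XY s) l p q
  simp only [expXY_zero] at h
  exact h.symm

/-- The expansion of `((x - z) - (y - z))^l` in nonnegative powers of `y - z` is `(x - y)^l`, in the
domain `|x| > |y| > |z|`. -/
theorem binExp_expXZ_expYZ (hG : IteratedLaurent G) (l k m p q s : ℤ) :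
    binExp l (fun k m => Toroidal.expXZ k (Toroidal.expYZ m G) p q s) k m
      = Toroidal.expXY l (Toroidal.expXZ k (Toroidal.expYZ m G)) p q s := by
  have hT : ∀ p q s, LowerTruncated fun k m => Toroidal.expXZ k (Toroidal.expYZ m G) p q s := by
    intro p q s
    obtain ⟨Q, hQ⟩ := hG.exists_expXZ_expYZ_eq_zero s
    exact ⟨Q - q, fun m hm k => hQ k m p q (by omega)⟩
  have hrec : ∀ l p q, binExp (l + 1)
        (fun k m => Toroidal.expXZ k (Toroidal.expYZ m G) p q s) k m
      = binExp l (fun k m => Toroidal.expXZ k (Toroidal.expYZ m G) (p + 1) q s) k m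
        - binExp l (fun k m => Toroidal.expXZ k (Toroidal.expYZ m G) p (q + 1) s) k m := by
    intro l p q
    have h1 := binExp_shift (fun k m => Toroidal.expXZ k (Toroidal.expYZ m G) p q s) 1 0 l k m
    have h2 := binExp_shift (fun k m => Toroidal.expXZ k (Toroidal.expYZ m G) p q s) 0 1 l k m
    simp only [add_zero] at h1 h2
    have h3 : ∀ k m, Toroidal.expXZ (k + 1) (Toroidal.expYZ m G) p q s
        = Toroidal.expXZ k (Toroidal.expYZ m G) (p + 1) q s
          - Toroidal.expXZ k (Toroidal.expYZ m G) p q (s + 1) := fun k m =>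
      binExp_succ ((hG.expYZ m).lowerTruncated_XZ q) k p s
    have h4 : ∀ k m, Toroidal.expXZ k (Toroidal.expYZ (m + 1) G) p q s
        = Toroidal.expXZ k (Toroidal.expYZ m G) p (q + 1) s
          - Toroidal.expXZ k (Toroidal.expYZ m G) p q (s + 1) := fun k m => by
      rw [expXZ_expYZ hG.truncZ, expXZ_expYZ hG.truncZ]
      exact binExp_succ ((hG.expXZ k).lowerTruncated_YZ p) m q s
    rw [binExp_succ (hT p q s), ← h1, ← h2]
    simp only [h3, h4]
    rw [binExp_sub (hT _ _ _) (hT _ _ _), binExp_sub (hT _ _ _) (hT _ _ _)]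
    abel
  have h := eq_binExp_of_recursion
    (L := fun l p q => binExp l (fun k m => Toroidal.expXZ k (Toroidal.expYZ m G) p q s) k m)
    hrec (fun l => ?_) l p q
  · simp only [binExp_zero] at h
    exact h
  · obtain ⟨Q, hQ⟩ := hG.exists_expXZ_expYZ_eq_zero s
    exact ⟨Q - m, fun q hq p => binExp_eq_zero (fun k i => hQ _ _ _ _ (by omega)) l k⟩

end IteratedLaurent

end ThreeVariables

/-! ### Fields in one variable, their products and locality -/

/-- A field in one variable on `W`: the family of the modes `f p : End W` of
`f(x) = ∑ f p x^{-p-1} ∈ Hom(W, W((x)))`. The rows `∑ a_{p,m} x₀^{-p-1}`, `m` fixed, of an element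
`a` of `VertexOps r W` are of this kind. -/
structure OneVarField (W : Type*) [AddCommGroup W] [Module ℂ W] where
  toFun : ℤ → Module.End ℂ W
  truncated : ∀ w : W, ∃ N : ℤ, ∀ p : ℤ, N ≤ p → toFun p w = 0

namespace OneVarField

variable {W : Type*} [AddCommGroup W] [Module ℂ W]

instance : CoeFun (OneVarField W) fun _ => ℤ → Module.End ℂ W := ⟨toFun⟩

theorem exists_nat_truncated (f : OneVarField W) (w : W) :
    ∃ N : ℕ, ∀ p : ℤ, (N : ℤ) ≤ p → f p w = 0 := by
  obtain ⟨N, hN⟩ := f.truncated w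
  exact ⟨N.toNat, fun p hp => hN p (by omega)⟩

/-- The series `f(x) g(y) w`. -/
def word (f g : OneVarField W) (w : W) (p q : ℤ) : W := f p (g q w)

theorem word_lowerTruncated (f g : OneVarField W) (w : W) : LowerTruncated (word f g w) := by
  obtain ⟨N, hN⟩ := g.truncated w
  exact ⟨N, fun q hq p => by rw [word, hN q hq, map_zero]⟩

theorem word_add (f g : OneVarField W) (w w' : W) :
    word f g (w + w') = fun p q => word f g w p q + word f g w' p q := by
  funext p q
  simp [word]

/-- The coefficients of `(x - y)^l f(x) g(y) w - (-y + x)^l g(y) f(x) w`. -/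
noncomputable def commDiff (f g : OneVarField W) (w : W) (l p q : ℤ) : W :=
  borcherdsDiff (word f g w) (word g f w) l p q

theorem commDiff_succ (f g : OneVarField W) (w : W) (l p q : ℤ) :
    commDiff f g w (l + 1) p q = commDiff f g w l (p + 1) q - commDiff f g w l p (q + 1) :=
  borcherdsDiff_succ (word_lowerTruncated f g w) (word_lowerTruncated g f w) l p q

theorem commDiff_add (f g : OneVarField W) (w w' : W) (l p q : ℤ) :
    commDiff f g (w + w') l p q = commDiff f g w l p q + commDiff f g w' l p q := by
  unfold commDiff
  rw [word_add, word_add]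
  exact borcherdsDiff_add (word_lowerTruncated f g w) (word_lowerTruncated g f w)
    (word_lowerTruncated f g w') (word_lowerTruncated g f w') l p q

theorem commDiff_smul (f g : OneVarField W) (c : ℂ) (w : W) (l p q : ℤ) :
    commDiff f g (c • w) l p q = c • commDiff f g w l p q := by
  have h := map_borcherdsDiff (word_lowerTruncated f g w) (word_lowerTruncated g f w)
    (DistribSMul.toAddMonoidHom W c) l p q
  have h1 : ∀ f g : OneVarField W, word f g (c • w) = fun p q => c • word f g w p q := by
    intro f g
    funext p q
    simp [word]
  rw [commDiff, h1, h1]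
  exact h.symm

theorem commDiff_zero_vector (f g : OneVarField W) (l p q : ℤ) :
    commDiff f g (0 : W) l p q = 0 := by
  simpa using commDiff_smul f g 0 (0 : W) l p q

theorem commDiff_zero (f g : OneVarField W) (w : W) (p q : ℤ) :
    commDiff f g w 0 p q = f p (g q w) - g q (f p w) := by
  simp [commDiff, borcherdsDiff, binExp_zero, word]

theorem commDiff_eq_binExp {f g : OneVarField W} {w : W} {a : ℤ} (ha : ∀ p, a ≤ p → f p w = 0)
    (l q : ℤ) : commDiff f g w l a q = binExp l (word f g w) a q := by
  rw [commDiff, borcherdsDiff, binExp_eq_zero (φ := word g f w) (q := a), smul_zero, sub_zero]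
  intro p i
  rw [word, ha _ (by omega), map_zero]

/-- Lower truncation of `f_(n) g`, uniformly in a uniformly truncated family of fields `g`. -/
theorem exists_commDiff_family_eq_zero {ι : Type*} (f : OneVarField W) (g : ι → OneVarField W)
    (hg : ∀ w : W, ∃ N : ℤ, ∀ p, N ≤ p → ∀ j, g j p w = 0) (w : W) (l p : ℤ) :
    ∃ S : ℤ, ∀ s, S ≤ s → ∀ j, commDiff f (g j) w l p s = 0 := by
  obtain ⟨N, hN⟩ := hg w
  obtain ⟨M, hM⟩ := f.truncated w
  choose R hR using fun i : ℤ => hg (f i w)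
  obtain ⟨B, hB⟩ := (Finset.Icc p M).image R |>.exists_le
  refine ⟨N ⊔ (B - l + (M - p).toNat), fun s hs j => ?_⟩
  -- only the finitely many modes `f i` with `p ≤ i ≤ M` occur, which bounds the powers uniformly
  have h1 : binExp l (word f (g j) w) p s = 0 := binExp_eq_zero (fun p i => by
    rw [word, hN _ (by omega), map_zero]) l p
  have h2 : binExp l (word (g j) f w) s p = 0 := by
    refine finsum_eq_zero_of_forall_eq_zero fun i => ?_
    by_cases hi : M ≤ p + i
    · rw [word, hM _ hi, map_zero, smul_zero]
    · rw [word, hR (p + i) _ ?_, smul_zero]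
      have := hB (R (p + i)) (Finset.mem_image_of_mem R (Finset.mem_Icc.2 ⟨by omega, by omega⟩))
      omega
  rw [commDiff, borcherdsDiff, h1, h2, smul_zero, sub_zero]

theorem exists_commDiff_eq_zero (f g : OneVarField W) (w : W) (l p : ℤ) :
    ∃ S : ℤ, ∀ s, S ≤ s → commDiff f g w l p s = 0 := by
  obtain ⟨S, hS⟩ := exists_commDiff_family_eq_zero f (fun _ : Unit => g)
    (fun w => (g.truncated w).imp fun N hN p hp _ => hN p hp) w l p
  exact ⟨S, fun s hs => hS s hs ()⟩

/-- The product `f_(n) g`, the residue in `x` of `(x - y)^n f(x) g(y) - (-y + x)^n g(y) f(x)`. -/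
noncomputable def prod (f g : OneVarField W) (n : ℤ) : OneVarField W where
  toFun s :=
    { toFun := fun w => commDiff f g w n 0 s
      map_add' := fun w w' => commDiff_add f g w w' n 0 s
      map_smul' := fun c w => commDiff_smul f g c w n 0 s }
  truncated w := exists_commDiff_eq_zero f g w n 0

/-- `(x - y)^k [f(x), g(y)] = 0`. -/
def LocalOfOrder (k : ℕ) (f g : OneVarField W) : Prop :=
  ∀ w p q, commDiff f g w k p q = 0

theorem LocalOfOrder.commDiff_eq_zero {k : ℕ} {f g : OneVarField W} (h : LocalOfOrder k f g)
    {l : ℤ} (hl : k ≤ l) (w : W) (p q : ℤ) : commDiff f g w l p q = 0 :=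
  borcherdsDiff_eq_zero_of_le (commDiff_succ f g w) hl (h w) p q

theorem LocalOfOrder.mono {k l : ℕ} {f g : OneVarField W} (h : LocalOfOrder k f g)
    (hl : k ≤ l) : LocalOfOrder l f g :=
  fun w p q => h.commDiff_eq_zero (by exact_mod_cast hl) w p q

theorem LocalOfOrder.prod_eq_zero {k : ℕ} {f g : OneVarField W} (h : LocalOfOrder k f g)
    {n : ℤ} (hn : k ≤ n) (s : ℤ) (w : W) : prod f g n s w = 0 :=
  h.commDiff_eq_zero hn w 0 s

theorem commDiff_swap (f g : OneVarField W) (w : W) (l : ℕ) (p q : ℤ) :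
    commDiff g f w l q p = (-1 : ℤ) ^ (l + 1) • commDiff f g w l p q := by
  induction l generalizing p q with
  | zero => simp [commDiff_zero]
  | succ l ih =>
    rw [Nat.cast_succ, commDiff_succ, commDiff_succ, ih, ih, pow_succ _ (l + 1), mul_neg_one,
      neg_smul, smul_sub, neg_sub]

theorem LocalOfOrder.symm {k : ℕ} {f g : OneVarField W} (h : LocalOfOrder k f g) :
    LocalOfOrder k g f := fun w p q => by
  rw [commDiff_swap, h, smul_zero]

/-- `(x - z)^k (y - z)^k` commutes `h(z)` past `f(x) g(y)`. -/
theorem shift_pow_word_comm_eq_zero (f g h : OneVarField W) (w : W) (k : ℕ)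
    (hgh : LocalOfOrder k g h) (hfh : LocalOfOrder k f h) :
    ((shiftX - shiftZ) ^ k * (shiftY - shiftZ) ^ k : TripleEnd W)
      (fun p q s => f p (g q (h s w)) - h s (f p (g q w))) = 0 := by
  have hcomm : Commute (shiftX - shiftZ : TripleEnd W) (shiftY - shiftZ) := commute_XZ_YZ
  have hsplit : (fun p q s => f p (g q (h s w)) - h s (f p (g q w)))
      = (fun p q s => f p (commDiff g h w 0 q s))
        + fun p q s => commDiff f h (g q w) 0 p s := by
    funext p q s
    simp [commDiff_zero]
  have h1 : ((shiftY - shiftZ) ^ k : TripleEnd W)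
      (fun p q s => f p (commDiff g h w 0 q s)) = 0 := by
    funext p q s
    rw [shiftY_sub_pow_apply (E := fun l q s => f p (commDiff g h w l q s))
      (fun l q s => by rw [commDiff_succ, map_sub]) (fun _ _ => rfl), hgh, map_zero]
    rfl
  have h2 : ((shiftX - shiftZ) ^ k : TripleEnd W)
      (fun p q s => commDiff f h (g q w) 0 p s) = 0 := by
    funext p q s
    rw [shiftX_sub_pow_apply (E := commDiff f h (g q w)) (commDiff_succ f h _)
      (fun _ _ => rfl), hfh]
    rfl
  rw [hsplit, map_add, Module.End.mul_apply, h1, map_zero, zero_add, (hcomm.pow_pow k k).eq,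
    Module.End.mul_apply, h2, map_zero]

theorem word_comm_lowerTruncated (f g h : OneVarField W) (w : W) (s : ℤ) :
    LowerTruncated fun p q => f p (g q (h s w)) - h s (f p (g q w)) := by
  have h1 := word_lowerTruncated f g (h s w)
  have h2 := (word_lowerTruncated f g w).map (-(h s).toAddMonoidHom)
  simpa [word, sub_eq_add_neg] using h1.add h2

/-- The defect of locality of `f_(n) g` with respect to `h`, as a function of the additional mode
index `p`. -/
noncomputable def tripleComm (f g h : OneVarField W) (w : W) (n : ℤ) : ℤ → ℤ → ℤ → W :=
  fun p q s => commDiff f g (h s w) n p q - h s (commDiff f g w n p q)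

theorem tripleComm_eq (f g h : OneVarField W) (w : W) (n : ℤ) :
    tripleComm f g h w n
      = expXY n (fun p q s => f p (g q (h s w)) - h s (f p (g q w)))
        - (n.negOnePow : ℤ) •
          (swapXY : TripleEnd W)
            (expXY n (fun p q s => g p (f q (h s w)) - h s (g p (f q w)))) := by
  funext p q s
  have e : ∀ f g : OneVarField W, ∀ p q,
      expXY n (fun p q s => f p (g q (h s w)) - h s (f p (g q w))) p q s
      = binExp n (word f g (h s w)) p q - h s (binExp n (word f g w) p q) := by
    intro f g p q
    have hT : LowerTruncated fun p q => h s (word f g w p q) :=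
      (word_lowerTruncated f g w).map (h s).toAddMonoidHom
    rw [show h s (binExp n (word f g w) p q) = binExp n (fun p q => h s (word f g w p q)) p q from
      map_binExp (word_lowerTruncated f g w) (h s).toAddMonoidHom n p q]
    exact binExp_sub (word_lowerTruncated f g (h s w)) hT n p q
  have hs : ∀ G : ℤ → ℤ → ℤ → W, (swapXY : TripleEnd W) G p q s = G q p s := fun _ => rfl
  simp only [Pi.sub_apply, Pi.smul_apply, hs]
  rw [e f g, e g f]
  simp only [tripleComm, commDiff, borcherdsDiff, map_sub, map_zsmul, smul_sub]
  abel

/-- `(x - z)^k (y - z)^k` annihilates the commutator of `h(z)` with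
`(x - y)^n f(x) g(y) - (-y + x)^n g(y) f(x)`. -/
theorem shift_pow_tripleComm_eq_zero (f g h : OneVarField W) (w : W) (k : ℕ) (n : ℤ)
    (hgh : LocalOfOrder k g h) (hfh : LocalOfOrder k f h) :
    ((shiftX - shiftZ) ^ k * (shiftY - shiftZ) ^ k : TripleEnd W) (tripleComm f g h w n) = 0 := by
  set O : TripleEnd W := (shiftX - shiftZ) ^ k * (shiftY - shiftZ) ^ k with hO
  have hgood : CommutesWithExpXY O :=
    ((commutesWithExpXY_shiftX.sub commutesWithExpXY_shiftZ).pow k).mul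
      ((commutesWithExpXY_shiftY.sub commutesWithExpXY_shiftZ).pow k)
  have hcomm : Commute (shiftX - shiftZ : TripleEnd W) (shiftY - shiftZ) := commute_XZ_YZ
  have hswap : SemiconjBy (swapXY : TripleEnd W) (shiftX - shiftZ) (shiftY - shiftZ) := rfl
  have hswap' : SemiconjBy (swapXY : TripleEnd W) (shiftY - shiftZ) (shiftX - shiftZ) := rfl
  have hOswap : O * swapXY = swapXY * O := by
    have := (hswap.pow_right k).mul_right (hswap'.pow_right k)
    rw [hO, this.eq, (hcomm.pow_pow k k).eq]
  have hzero : ∀ f g : OneVarField W, LocalOfOrder k g h → LocalOfOrder k f h →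
      O (expXY n (fun p q s => f p (g q (h s w)) - h s (f p (g q w)))) = 0 := by
    intro f g h1 h2
    rw [← (hgood _ (word_comm_lowerTruncated f g h w)).2,
      shift_pow_word_comm_eq_zero f g h w k h1 h2]
    funext p q s
    exact binExp_eq_zero (fun _ _ => rfl) n p
  rw [tripleComm_eq, map_sub, map_zsmul, ← Module.End.mul_apply O, hOswap,
    Module.End.mul_apply swapXY O, hzero f g hgh hfh, hzero g f hfh hgh, map_zero, smul_zero,
    sub_zero]

theorem pow_sub_apply_eq_zero {V : Type*} [AddCommGroup V] {A B : Module.End ℤ V}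
    (hAB : Commute A B) {v : V} {k j : ℕ} (hA : (A ^ k) v = 0) (hB : (B ^ j) v = 0) :
    ((A - B) ^ (k + j)) v = 0 := by
  have hA' : ∀ i, k ≤ i → (A ^ i) v = 0 := fun i hi => by
    rw [← Nat.sub_add_cancel hi, pow_add, Module.End.mul_apply, hA, map_zero]
  have hB' : ∀ i, j ≤ i → (B ^ i) v = 0 := fun i hi => by
    rw [← Nat.sub_add_cancel hi, pow_add, Module.End.mul_apply, hB, map_zero]
  rw [sub_eq_add_neg, (hAB.neg_right).add_pow, LinearMap.sum_apply]
  refine Finset.sum_eq_zero fun i hi => ?_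
  rw [← (Nat.cast_commute _ _).eq, Module.End.mul_apply]
  by_cases h : k ≤ i
  · rw [((hAB.neg_right).pow_pow i _).eq, Module.End.mul_apply, hA' i h, map_zero, map_zero]
  · rw [neg_pow, Module.End.mul_apply, Module.End.mul_apply, hB' _ (by omega)]
    simp

/-- Dong's lemma, with an explicit order of locality depending only on the orders of the given
pairs. The binomial `y - z` is written as `(x - z) - (x - y)`. -/
theorem LocalOfOrder.prod {f g h : OneVarField W} {k : ℕ} (hfg : LocalOfOrder k f g)
    (hgh : LocalOfOrder k g h) (hfh : LocalOfOrder k f h) (n : ℤ) :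
    LocalOfOrder (k + (k - n).toNat + k) (prod f g n) h := by
  intro w q s
  have hE : ∀ q s, tripleComm f g h w n 0 q s = commDiff (OneVarField.prod f g n) h w 0 q s :=
    fun q s => by rw [commDiff_zero]; rfl
  rw [← shiftY_sub_pow_apply (D := tripleComm f g h w n) (p := 0) (commDiff_succ _ h w)
    (fun q s => (hE q s).symm)]
  set v : ℤ → ℤ → ℤ → W := ((shiftY - shiftZ) ^ k : TripleEnd W) (tripleComm f g h w n) with hv
  have hA : ((shiftX - shiftZ) ^ k : TripleEnd W) v = 0 :=
    shift_pow_tripleComm_eq_zero f g h w k n hgh hfh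
  have hstep : ∀ j : ℕ, ((shiftX - shiftY) ^ j : TripleEnd W) (tripleComm f g h w n)
      = tripleComm f g h w (n + j) := by
    intro j
    induction j with
    | zero => simp
    | succ j ih =>
      rw [pow_succ', Module.End.mul_apply, ih]
      funext p q s
      simp only [tripleComm, Nat.cast_succ, ← add_assoc, commDiff_succ, map_sub]
      change tripleComm f g h w (n + j) (p + 1) q s - tripleComm f g h w (n + j) p (q + 1) s = _
      simp only [tripleComm]
      abel
  have hB : ((shiftX - shiftY) ^ (k - n).toNat : TripleEnd W) v = 0 := by
    have hcomm : Commute (shiftX - shiftY : TripleEnd W) (shiftY - shiftZ) := commute_XY_YZ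
    rw [hv, ← Module.End.mul_apply, (hcomm.pow_pow _ _).eq, Module.End.mul_apply, hstep]
    have h0 : tripleComm f g h w (n + (k - n).toNat) = 0 := by
      funext p q s
      rw [tripleComm, hfg.commDiff_eq_zero (by omega), hfg.commDiff_eq_zero (by omega), map_zero,
        sub_zero]
      rfl
    rw [h0, map_zero]
  have hcomm : Commute (shiftX - shiftZ : TripleEnd W) (shiftX - shiftY) := commute_XZ_XY
  have hfinal := pow_sub_apply_eq_zero hcomm hA hB
  rw [show (shiftX - shiftZ - (shiftX - shiftY) : TripleEnd W) = shiftY - shiftZ by abel, hv,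
    ← Module.End.mul_apply, ← pow_add] at hfinal
  rw [hfinal]
  rfl

/-! ### The Borcherds identity for products of fields -/

/-- The coefficients of `f(x) g(y) h(z) w`. -/
def tripleWord (f g h : OneVarField W) (w : W) (p q s : ℤ) : W := f p (g q (h s w))

theorem tripleWord_iteratedLaurent (f g h : OneVarField W) (w : W) :
    IteratedLaurent (tripleWord f g h w) := by
  obtain ⟨S, hS⟩ := h.truncated w
  choose R hR using fun s : ℤ => g.truncated (h s w)
  refine ⟨⟨S, fun s hs p q => by simp [tripleWord, hS s hs]⟩, fun s₀ => ?_⟩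
  obtain ⟨B, hB⟩ := (Finset.Icc s₀ S).image R |>.exists_le
  refine ⟨B, fun s hs q hq p => ?_⟩
  by_cases h1 : S ≤ s
  · simp [tripleWord, hS s h1]
  · have := hB (R s) (Finset.mem_image_of_mem R (Finset.mem_Icc.2 ⟨hs, by omega⟩))
    rw [tripleWord, hR s q (by omega), map_zero]

/-- Multiplying `Y(f; x) h(z) w` by `(x + z)^a` moves the base point of the expansion: one gets
`(x₁ - z)^p f(x₁) h(z) w - (-z + x₁)^p h(z) f(x₁) w` at the power `x₁^a`. -/
theorem shiftX_add_pow_prod {K : ℤ → ℤ → ℤ → W} {f c : OneVarField W} {w : W} {q : ℤ}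
    (hK : ∀ p s, K p q s = prod f c p s w) (a : ℕ) (p s : ℤ) :
    ((shiftX + shiftZ) ^ a : TripleEnd W) K p q s = commDiff f c w p a s :=
  shiftX_add_pow_apply (E := fun a p s => commDiff f c w p a s)
    (fun a p s => by rw [commDiff_succ, Nat.cast_succ]; abel) (fun p s => (hK p s).symm) a p s

theorem shiftY_add_pow_prod {K : ℤ → ℤ → ℤ → W} {g c : OneVarField W} {w : W} {p : ℤ}
    (hK : ∀ q s, K p q s = prod g c q s w) (b : ℕ) (q s : ℤ) :
    ((shiftY + shiftZ) ^ b : TripleEnd W) K p q s = commDiff g c w q b s :=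
  shiftY_add_pow_apply (E := fun b q s => commDiff g c w q b s)
    (fun a p s => by rw [commDiff_succ, Nat.cast_succ]; abel) (fun p s => (hK p s).symm) b q s

/-- The coefficients of `Y(f; x) Y(g; y) h(z) w`. -/
noncomputable def nestedProd (f g h : OneVarField W) (w : W) (p q s : ℤ) : W :=
  prod f (prod g h q) p s w

/-- Weak associativity, applied twice: after multiplication by `(x + z)^a (y + z)^b`, the nested
product becomes `f(x + z) g(y + z) h(z) w`. -/
theorem shift_pow_nestedProd (f g h : OneVarField W) (w : W) {a b : ℕ}
    (ha : ∀ p : ℤ, a ≤ p → f p w = 0) (hb : ∀ q : ℤ, b ≤ q → g q w = 0) (p q s : ℤ) :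
    ((shiftY + shiftZ) ^ b * (shiftX + shiftZ) ^ a : TripleEnd W) (nestedProd f g h w) p q s
      = expXZ p (expYZ q (tripleWord f g h w)) a b s := by
  have hT : ∀ b q, LowerTruncated fun p s => f p (commDiff g h w q b s) := fun b q => by
    obtain ⟨S, hS⟩ := exists_commDiff_eq_zero g h w q b
    exact ⟨S, fun s hs p => by simp [hS s hs]⟩
  rw [Module.End.mul_apply, shiftY_add_pow_apply
    (E := fun b q s => binExp p (fun p s => f p (commDiff g h w q b s)) a s)]
  · refine binExp_congr (fun p i => ?_) p _
    rw [commDiff_eq_binExp hb]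
    exact map_binExp (word_lowerTruncated g h w) (f p).toAddMonoidHom q b _
  · intro b q s
    have h1 := binExp_shift (fun p s => f p (commDiff g h w q b s)) 0 1 p a s
    have h2 : LowerTruncated fun p s => f p (commDiff g h w q b (s + 1)) := by
      simpa using (hT b q).shift 0 1
    simp only [add_zero] at h1
    rw [← h1, ← binExp_add (hT b (q + 1)) h2]
    refine binExp_congr (fun p i => ?_) p _
    rw [Nat.cast_succ, ← map_add, commDiff_succ]
    abel_nf
  · intro q s
    rw [shiftX_add_pow_prod (fun p s => rfl), commDiff_eq_binExp ha]
    exact binExp_congr (fun p i => rfl) p _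

theorem nestedProd_eq_zero {k : ℕ} {g h : OneVarField W} (f : OneVarField W)
    (hgh : LocalOfOrder k g h) {q : ℤ} (hq : k ≤ q) (w : W) (p s : ℤ) :
    nestedProd f g h w p q s = 0 := by
  have h0 : ∀ s w, prod g h q s w = 0 := hgh.prod_eq_zero hq
  have h1 : word f (prod g h q) w = fun _ _ => 0 := by
    funext p q; rw [word, h0, map_zero]
  have h2 : word (prod g h q) f w = fun _ _ => 0 := by
    funext p q; rw [word, h0]
  change commDiff f (prod g h q) w p 0 s = 0
  rw [commDiff, borcherdsDiff, h1, h2, binExp_eq_zero (fun _ _ => rfl),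
    binExp_eq_zero (fun _ _ => rfl), smul_zero, sub_zero]

theorem nestedProd_lowerTruncated {k : ℕ} {g h : OneVarField W} (f : OneVarField W)
    (hgh : LocalOfOrder k g h) (w : W) (s : ℤ) :
    LowerTruncated fun p q => nestedProd f g h w p q s :=
  ⟨k, fun _ hq p => nestedProd_eq_zero f hgh hq w p s⟩

/-- The coefficients of `(x - y)^l Y(f; x) Y(g; y) h(z) w - (-y + x)^l Y(g; y) Y(f; x) h(z) w`. -/
noncomputable def nestedDiff (f g h : OneVarField W) (w : W) (l p q s : ℤ) : W :=
  borcherdsDiff (fun p q => nestedProd f g h w p q s) (fun q p => nestedProd g f h w q p s) l p q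

theorem nestedDiff_eq (f g h : OneVarField W) (w : W) (l : ℤ) :
    nestedDiff f g h w l = expXY l (nestedProd f g h w)
      - (l.negOnePow : ℤ) • (swapXY : TripleEnd W) (expXY l (nestedProd g f h w)) := by
  have hs : ∀ G : ℤ → ℤ → ℤ → W, (swapXY : TripleEnd W) G = fun p q s => G q p s := fun _ => rfl
  funext p q s
  simp only [Pi.sub_apply, Pi.smul_apply, hs]
  rfl

theorem nestedDiff_succ {k : ℕ} {f g h : OneVarField W} (hfh : LocalOfOrder k f h)
    (hgh : LocalOfOrder k g h) (w : W) (l p q s : ℤ) :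
    nestedDiff f g h w (l + 1) p q s
      = nestedDiff f g h w l (p + 1) q s - nestedDiff f g h w l p (q + 1) s :=
  borcherdsDiff_succ (nestedProd_lowerTruncated f hgh w s) (nestedProd_lowerTruncated g hfh w s)
    l p q

theorem commDiff_vector_truncated (f g h : OneVarField W) (w : W) :
    ∃ S : ℤ, ∀ s, S ≤ s → ∀ l p q, commDiff f g (h s w) l p q = 0 := by
  obtain ⟨S, hS⟩ := h.truncated w
  exact ⟨S, fun s hs l p q => by rw [hS s hs, commDiff_zero_vector]⟩

/-- The defect of locality of `Y(f; x)` and `Y(g; y)` on `h(z) w` becomes, after multiplication by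
`(x + z)^a (y + z)^b`, the defect of locality of `f` and `g` on `h(z) w`. -/
theorem shift_pow_nestedDiff {k : ℕ} {f g h : OneVarField W} (hfh : LocalOfOrder k f h)
    (hgh : LocalOfOrder k g h) (w : W) {a b : ℕ}
    (ha : ∀ p : ℤ, a ≤ p → f p w = 0) (hb : ∀ q : ℤ, b ≤ q → g q w = 0) (l p q s : ℤ) :
    ((shiftY + shiftZ) ^ b * (shiftX + shiftZ) ^ a : TripleEnd W) (nestedDiff f g h w l) p q s
      = expXZ p (expYZ q fun p q s => commDiff f g (h s w) l p q) a b s := by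
  have hcX : CommutesWithExpXY (shiftX + shiftZ : TripleEnd W) :=
    commutesWithExpXY_shiftX.add commutesWithExpXY_shiftZ
  have hcY : CommutesWithExpXY (shiftY + shiftZ : TripleEnd W) :=
    commutesWithExpXY_shiftY.add commutesWithExpXY_shiftZ
  have hcomm : Commute (shiftX + shiftZ : TripleEnd W) (shiftY + shiftZ) :=
    (commute_shiftX_shiftY.add_right commute_shiftX_shiftZ).add_left
      (commute_shiftY_shiftZ.symm.add_right (Commute.refl _))
  have hswap : SemiconjBy (swapXY : TripleEnd W) (shiftX + shiftZ) (shiftY + shiftZ) := rfl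
  have hswap' : SemiconjBy (swapXY : TripleEnd W) (shiftY + shiftZ) (shiftX + shiftZ) := rfl
  have hs : ∀ G : ℤ → ℤ → ℤ → W, (swapXY : TripleEnd W) G = fun p q s => G q p s := fun _ => rfl
  -- one word at a time
  have hword : ∀ f g : OneVarField W, ∀ a b : ℕ, LocalOfOrder k g h →
      (∀ p : ℤ, a ≤ p → f p w = 0) → (∀ q : ℤ, b ≤ q → g q w = 0) → ∀ p q s,
      ((shiftY + shiftZ) ^ b * (shiftX + shiftZ) ^ a : TripleEnd W)
        (expXY l (nestedProd f g h w)) p q s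
      = expXZ p (expYZ q (expXY l (tripleWord f g h w))) a b s := by
    intro f g a b hgh ha hb p q s
    have hG := tripleWord_iteratedLaurent f g h w
    rw [← (((hcY.pow b).mul (hcX.pow a)) _ (nestedProd_lowerTruncated f hgh w)).2 l,
      ← hG.expXY_expYZ, ← (hG.expYZ q).expXY_expXZ, ← hG.binExp_expXZ_expYZ]
    exact binExp_congr (fun p i => shift_pow_nestedProd f g h w ha hb p _ s) l p
  have hS : ((shiftY + shiftZ) ^ b * (shiftX + shiftZ) ^ a : TripleEnd W) * swapXY
      = swapXY * ((shiftY + shiftZ) ^ a * (shiftX + shiftZ) ^ b) := by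
    rw [← ((hswap.pow_right b).mul_right (hswap'.pow_right a)).eq,
      (hcomm.pow_pow b a).eq]
  have hG := (tripleWord_iteratedLaurent f g h w).expXY l
  have hG' := (tripleWord_iteratedLaurent g f h w).expXY l
  rw [nestedDiff_eq, map_sub, map_zsmul,
    ← Module.End.mul_apply ((shiftY + shiftZ) ^ b * (shiftX + shiftZ) ^ a) swapXY, hS,
    Module.End.mul_apply swapXY, hs]
  simp only [Pi.sub_apply, Pi.smul_apply]
  rw [hword f g a b hgh ha hb, hword g f b a hfh hb ha]
  set B : ℤ → ℤ → ℤ → W := expXY l (tripleWord f g h w)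
  set B' : ℤ → ℤ → ℤ → W := fun p q s => expXY l (tripleWord g f h w) q p s with hB'
  have hTB' : ∃ S : ℤ, ∀ s, S ≤ s → ∀ p q, B' p q s = 0 := by
    obtain ⟨S, hS⟩ := hG'.truncZ
    exact ⟨S, fun s hs p q => hS s hs q p⟩
  have hsw : expXZ q (expYZ p (expXY l (tripleWord g f h w))) b a s
      = expXZ p (expYZ q B') a b s := by
    rw [expXZ_expYZ hTB']
    rfl
  have hYZ : (expYZ q fun p q s => commDiff f g (h s w) l p q)
      = fun p' q' s' => expYZ q B p' q' s' - (l.negOnePow : ℤ) • expYZ q B' p' q' s' := by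
    funext p' q' s'
    obtain ⟨S, hS⟩ := hTB'
    exact binExp_sub_zsmul (hG.lowerTruncated_YZ p') ⟨S, fun s hs q => hS s hs p' q⟩ _ q q' s'
  have hTB'Y : LowerTruncated fun p' s' => expYZ q B' p' b s' := by
    obtain ⟨S, hS⟩ := hTB'
    exact ⟨S, fun s hs p => binExp_eq_zero (fun q i => hS _ (by omega) p q) q b⟩
  rw [hsw, hYZ]
  exact (binExp_sub_zsmul ((hG.expYZ q).lowerTruncated_XZ b) hTB'Y _ p a s).symm

theorem exists_prod_order {k : ℕ} {f g h : OneVarField W} (hfg : LocalOfOrder k f g)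
    (hfh : LocalOfOrder k f h) (hgh : LocalOfOrder k g h) (n : ℤ) :
    ∃ K : ℕ, LocalOfOrder K f (prod g h n) :=
  ⟨_, (hgh.prod hfh.symm hfg.symm n).symm⟩

theorem exists_binExp_nestedProd_eq_zero {k : ℕ} {f g h : OneVarField W} (hfg : LocalOfOrder k f g)
    (hfh : LocalOfOrder k f h) (hgh : LocalOfOrder k g h) (w : W) (l p : ℤ) :
    ∃ Q : ℤ, ∀ q, Q ≤ q → ∀ s, binExp l (fun q p => nestedProd g f h w q p s) q p = 0 := by
  choose K hK using fun p : ℤ => exists_prod_order hfg.symm hgh hfh p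
  obtain ⟨B, hB⟩ := (Finset.Icc p k).image K |>.exists_le
  refine ⟨B - l + (k - p).toNat, fun q hq s => finsum_eq_zero_of_forall_eq_zero fun i => ?_⟩
  dsimp only
  by_cases hi : (k : ℤ) ≤ p + i
  · rw [nestedProd_eq_zero g hfh hi, smul_zero]
  · have := hB (K (p + i)) (Finset.mem_image_of_mem K (Finset.mem_Icc.2 ⟨by omega, by omega⟩))
    rw [nestedProd, (hK (p + i)).prod_eq_zero (by omega), smul_zero]

/-- The truncation in `y` is uniform in the power of `z`; this is where Dong's lemma enters
the Borcherds identity. -/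
theorem exists_nestedDiff_eq_zero {k : ℕ} {f g h : OneVarField W} (hfg : LocalOfOrder k f g)
    (hfh : LocalOfOrder k f h) (hgh : LocalOfOrder k g h) (w : W) (l p : ℤ) :
    ∃ Q : ℤ, ∀ q, Q ≤ q → ∀ s, nestedDiff f g h w l p q s = 0 := by
  obtain ⟨Q, hQ⟩ := exists_binExp_nestedProd_eq_zero hfg hfh hgh w l p
  refine ⟨Q ⊔ k, fun q hq s => ?_⟩
  rw [nestedDiff, borcherdsDiff, hQ q (le_trans le_sup_left hq), smul_zero, sub_zero]
  exact binExp_eq_zero (fun p i => nestedProd_eq_zero f hgh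
    (le_trans (le_trans le_sup_right hq) (by omega)) w p s) l p

theorem nestedDiff_swap (f g h : OneVarField W) (w : W) (l p q s : ℤ) :
    nestedDiff f g h w l p q s = -(l.negOnePow : ℤ) • nestedDiff g f h w l q p s := by
  have h1 : (l.negOnePow : ℤ) * (l.negOnePow : ℤ) = 1 := by
    rw [← Units.val_mul, ← Int.negOnePow_add, Int.negOnePow_even _ ⟨l, rfl⟩, Units.val_one]
  unfold nestedDiff borcherdsDiff
  rw [smul_sub, smul_smul, neg_mul, h1, neg_smul, neg_smul, one_smul]
  abel

/-- The operators `Y(f; x)` and `Y(g; y)` are local, of the same order as `f` and `g`. -/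
theorem nestedDiff_eq_zero {k : ℕ} {f g h : OneVarField W} (hfg : LocalOfOrder k f g)
    (hfh : LocalOfOrder k f h) (hgh : LocalOfOrder k g h) {l : ℤ} (hl : k ≤ l) (w : W)
    (p q s : ℤ) : nestedDiff f g h w l p q s = 0 := by
  obtain ⟨a, ha⟩ := f.exists_nat_truncated w
  obtain ⟨b, hb⟩ := g.exists_nat_truncated w
  have hB : (fun p q s => commDiff f g (h s w) l p q) = 0 := by
    funext p q s
    exact hfg.commDiff_eq_zero hl _ p q
  have hzero : ∀ p q s, ((shiftY + shiftZ) ^ b * (shiftX + shiftZ) ^ a : TripleEnd W)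
      (nestedDiff f g h w l) p q s = 0 := by
    intro p q s
    refine (shift_pow_nestedDiff hfh hgh w ha hb l p q s).trans ?_
    rw [hB]
    exact binExp_eq_zero (fun p i => binExp_eq_zero (fun _ _ => rfl) q _) p _
  -- truncation in `y` for fixed powers of `x` survives multiplication by `(x + z)^a`
  have htrunc : ∀ a : ℕ, ∀ p, ∃ Q : ℤ, ∀ q, Q ≤ q → ∀ s,
      ((shiftX + shiftZ) ^ a : TripleEnd W) (nestedDiff f g h w l) p q s = 0 := by
    intro a
    induction a with
    | zero => exact exists_nestedDiff_eq_zero hfg hfh hgh w l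
    | succ a ih =>
      intro p
      obtain ⟨Q, hQ⟩ := ih p
      obtain ⟨R, hR⟩ := ih (p + 1)
      refine ⟨Q ⊔ R, fun q hq s => ?_⟩
      rw [pow_succ', Module.End.mul_apply]
      exact (congrArg₂ (· + ·) (hR q (le_trans le_sup_right hq) s)
        (hQ q (le_trans le_sup_left hq) (s + 1))).trans (add_zero 0)
  have hX : ∀ p q s, ((shiftX + shiftZ) ^ a : TripleEnd W) (nestedDiff f g h w l) p q s = 0 := by
    intro p
    obtain ⟨Q, hQ⟩ := htrunc a p
    exact eq_zero_of_shiftY_add_pow hQ b (hzero p)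
  obtain ⟨P, hP⟩ := exists_nestedDiff_eq_zero hfg.symm hgh hfh w l q
  exact eq_zero_of_shiftX_add_pow (P := P)
    (fun p hp s => by rw [nestedDiff_swap, hP p hp, smul_zero]) a (fun p s => hX p q s) p s

/-- The coefficients of `Y(Y(f; u) g; y) h(z) w`. -/
noncomputable def iteratedProd (f g h : OneVarField W) (w : W) (l q s : ℤ) : W :=
  prod (prod f g l) h q s w

/-- The iterate `Y(Y(f; u) g; y) h(z) w` becomes, after multiplication by
`(u + y + z)^a (y + z)^b`, the same expression as `nestedDiff f g h w l 0` after multiplication by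
`(x + z)^a (y + z)^b`. -/
theorem shift_pow_iteratedProd (f g h : OneVarField W) (w : W) (a b : ℕ) (l : ℤ)
    (hb : ∀ l', l ≤ l' → l' ≤ l + a → ∀ q : ℤ, b ≤ q → prod f g l' q w = 0) (q s : ℤ) :
    ((shiftX + (shiftY + shiftZ)) ^ a * (shiftY + shiftZ) ^ b : TripleEnd W)
      (iteratedProd f g h w) l q s
      = binExp q (fun b s => commDiff f g (h s w) l a b) b s := by
  have hcomm : Commute (shiftX : TripleEnd W) (shiftY + shiftZ) :=
    commute_shiftX_shiftY.add_right commute_shiftX_shiftZ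
  induction a generalizing b l q s with
  | zero =>
    rw [pow_zero, one_mul, shiftY_add_pow_prod (fun q s => rfl),
      commDiff_eq_binExp (hb l le_rfl (by simp))]
    rfl
  | succ a ih =>
    have hT : ∀ l a : ℤ, LowerTruncated fun b s => commDiff f g (h s w) l a b := by
      intro l a
      obtain ⟨S, hS⟩ := commDiff_vector_truncated f g h w
      exact ⟨S, fun s hs b => hS s hs l a b⟩
    have h1 := ih b (l + 1) (fun l' h1 h2 => hb l' (by omega) (by push_cast; omega)) q s
    have h2 := ih (b + 1) l (fun l' h1 h2 q hq => hb l' h1 (by push_cast; omega) q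
      (by push_cast at hq; omega)) q s
    have hsplit : ((shiftX + (shiftY + shiftZ)) ^ (a + 1) * (shiftY + shiftZ) ^ b : TripleEnd W)
        = shiftX * ((shiftX + (shiftY + shiftZ)) ^ a * (shiftY + shiftZ) ^ b)
          + (shiftX + (shiftY + shiftZ)) ^ a * (shiftY + shiftZ) ^ (b + 1) := by
      have hc : Commute (shiftX + (shiftY + shiftZ) : TripleEnd W) (shiftY + shiftZ) :=
        hcomm.add_left (Commute.refl _)
      rw [pow_succ' _ a, mul_assoc, add_mul, pow_succ' _ b, ← mul_assoc (shiftY + shiftZ),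
        ← (hc.pow_left a).eq, mul_assoc]
    rw [hsplit]
    refine (congrArg₂ (· + ·) h1 h2).trans ?_
    have h3 := binExp_shift (fun b s => commDiff f g (h s w) l a b) 1 0 q b s
    have h4 : LowerTruncated fun b s => commDiff f g (h s w) l a (b + 1) := by
      simpa using (hT l a).shift 1 0
    simp only [add_zero] at h3
    rw [Nat.cast_succ b, ← h3]
    refine (binExp_add (hT (l + 1) a) h4 q b s).symm.trans (binExp_congr (fun b i => ?_) q b)
    rw [commDiff_succ, Nat.cast_succ, sub_add_cancel]

/-- The iterate formula: the part `p = 0` of the Borcherds identity. It holds for large `l`, where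
both sides vanish, and descends in `l` since multiplication by a power of `y + z` is injective. -/
theorem nestedDiff_zero_eq {k : ℕ} {f g h : OneVarField W} (hfg : LocalOfOrder k f g)
    (hfh : LocalOfOrder k f h) (hgh : LocalOfOrder k g h) (w : W) (l q s : ℤ) :
    nestedDiff f g h w l 0 q s = iteratedProd f g h w l q s := by
  rw [← sub_eq_zero]
  set D : ℤ → ℤ → ℤ → W :=
    fun l q s => nestedDiff f g h w l 0 q s - iteratedProd f g h w l q s with hD
  suffices key : ∀ n : ℕ, ∀ l, (k : ℤ) ≤ l + n → ∀ q s, D l q s = 0 from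
    key (k - l).toNat l (by omega) q s
  intro n
  induction n with
  | zero =>
    intro l hl q s
    have h0 : ∀ s w, prod f g l s w = 0 := hfg.prod_eq_zero (by simpa using hl)
    have h1 : LocalOfOrder 0 (prod f g l) h := fun w p q => by
      rw [Nat.cast_zero, commDiff_zero, h0, h0, map_zero, sub_zero]
    have h2 : iteratedProd f g h w l q s = 0 := by
      change commDiff (prod f g l) h w q 0 s = 0
      have e1 : word (prod f g l) h w = fun _ _ => 0 := by funext p q; rw [word, h0]
      have e2 : word h (prod f g l) w = fun _ _ => 0 := by funext p q; rw [word, h0, map_zero]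
      rw [commDiff, borcherdsDiff, e1, e2, binExp_eq_zero (fun _ _ => rfl),
        binExp_eq_zero (fun _ _ => rfl), smul_zero, sub_zero]
    rw [hD]
    dsimp only
    rw [h2, nestedDiff_eq_zero hfg hfh hgh (by simpa using hl), sub_zero]
  | succ n ih =>
    intro l hl
    have hvan : ∀ l', l < l' → ∀ q s, D l' q s = 0 := fun l' hl' =>
      ih l' (by push_cast at hl; omega)
    obtain ⟨a, ha⟩ := f.exists_nat_truncated w
    obtain ⟨b₀, hb₀⟩ := g.exists_nat_truncated w
    choose N hN using fun l' : ℤ => (prod f g l').exists_nat_truncated w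
    obtain ⟨b₁, hb₁⟩ := (Finset.Icc l (l + a)).image N |>.exists_le
    set b : ℕ := b₀ ⊔ b₁
    have hb : ∀ q : ℤ, b ≤ q → g q w = 0 := fun q hq =>
      hb₀ q (le_trans (by exact_mod_cast le_sup_left) hq)
    have hb' : ∀ l', l ≤ l' → l' ≤ l + a → ∀ q : ℤ, b ≤ q → prod f g l' q w = 0 := by
      intro l' h1 h2 q hq
      refine hN l' q (le_trans ?_ hq)
      have h3 := hb₁ (N l') (Finset.mem_image_of_mem N (Finset.mem_Icc.2 ⟨h1, h2⟩))
      exact_mod_cast le_trans h3 le_sup_right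
    -- both sides agree after multiplication by `(u + y + z)^a (y + z)^b`
    have hcomm : Commute (shiftX + (shiftY + shiftZ) : TripleEnd W) (shiftY + shiftZ) :=
      (commute_shiftX_shiftY.add_right commute_shiftX_shiftZ).add_left (Commute.refl _)
    have hnested : ∀ q s, ((shiftY + shiftZ) ^ b : TripleEnd W)
        (((shiftX + (shiftY + shiftZ)) ^ a : TripleEnd W)
          (fun l q s => nestedDiff f g h w l 0 q s)) l q s
        = binExp q (fun b s => commDiff f g (h s w) l a b) b s := by
      intro q s
      have h1 := shift_pow_nestedDiff hfh hgh w ha hb l 0 q s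
      rw [Module.End.mul_apply] at h1
      rw [← shiftY_add_pow_slice_congr (fun q s => shiftX_add_pow_of_recursion
        (E := nestedDiff f g h w) (nestedDiff_succ hfh hgh w) a l 0 q s), h1]
      exact binExp_zero _ _ _
    have hdiff : ∀ q s, ((shiftY + shiftZ) ^ b : TripleEnd W)
        (((shiftX + (shiftY + shiftZ)) ^ a : TripleEnd W) D) l q s = 0 := by
      intro q s
      have h1 := shift_pow_iteratedProd f g h w a b l hb' q s
      rw [(hcomm.pow_pow a b).eq, Module.End.mul_apply] at h1
      have h2 : D = (fun l q s => nestedDiff f g h w l 0 q s) - iteratedProd f g h w := rfl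
      rw [h2, map_sub, map_sub, Pi.sub_apply, Pi.sub_apply, Pi.sub_apply, hnested, h1, sub_self]
    obtain ⟨K, hK⟩ : ∃ K, LocalOfOrder K (prod f g l) h := ⟨_, hfg.prod hgh hfh l⟩
    obtain ⟨Q, hQ⟩ := exists_nestedDiff_eq_zero hfg hfh hgh w l 0
    refine eq_zero_of_shiftY_add_pow (Q := Q ⊔ K) (fun q hq s => ?_) (b + a) (fun q s => ?_)
    · rw [hD]
      dsimp only
      rw [hQ q (le_trans le_sup_left hq), iteratedProd,
        hK.prod_eq_zero (le_trans le_sup_right hq), sub_zero]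
    · rw [pow_add, Module.End.mul_apply, ← hdiff q s]
      exact shiftY_add_pow_slice_congr
        (fun q s => (shift_pow_apply_of_vanishing hvan a le_rfl q s).symm) b q s

/-- The Borcherds identity for products of pairwise local fields. -/
theorem borcherds_identity {k : ℕ} {f g h : OneVarField W} (hfg : LocalOfOrder k f g)
    (hfh : LocalOfOrder k f h) (hgh : LocalOfOrder k g h) (w : W) (l p q s : ℤ) :
    nestedDiff f g h w l p q s
      = ∑ᶠ i : ℕ, Ring.choose p i • prod (prod f g (l + i)) h (p + q - i) s w := by
  rw [eq_finsum_of_recursion (E := fun l p q => nestedDiff f g h w l p q s)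
    (fun l p q => nestedDiff_succ hfh hgh w l p q s)
    (fun p q => nestedDiff_eq_zero hfg hfh hgh le_rfl w p q s)]
  exact finsum_congr fun i => by rw [nestedDiff_zero_eq hfg hfh hgh]; rfl

end OneVarField

/-! ### The coefficients of `G(y₀ + z₀, y₀)` -/

section Substitution

variable {M : Type*} [AddCommGroup M]

/-- A family obeying the recursion of `(x - y)^l` which is truncated below in `x` and vanishes for
some `l ≥ k` vanishes for `l = k`. -/
theorem eq_zero_of_recursion {E : ℤ → ℤ → ℤ → M}
    (hE : ∀ l p q, E (l + 1) p q = E l (p + 1) q - E l p (q + 1)) {k P : ℤ}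
    (hP : ∀ p, P ≤ p → ∀ q, E k p q = 0) (j : ℕ) (hj : ∀ p q, E (k + j) p q = 0) (p q : ℤ) :
    E k p q = 0 := by
  have htr : ∀ i : ℕ, ∀ p, P ≤ p → ∀ q, E (k + i) p q = 0 := by
    intro i
    induction i with
    | zero => simpa using hP
    | succ i ih =>
      intro p hp q
      rw [Nat.cast_succ, ← add_assoc, hE, ih _ (by omega), ih _ hp, sub_zero]
  induction j generalizing p q with
  | zero => simpa using hj p q
  | succ j ih =>
    refine ih (fun p q => ?_) p q
    have key : ∀ n : ℕ, ∀ p q, P ≤ p + n → E (k + j) p q = 0 := by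
      intro n
      induction n with
      | zero => exact fun p q hp => htr j p (by simpa using hp) q
      | succ n ihn =>
        intro p q hp
        have h1 := hE (k + j) p (q - 1)
        have h2 := hj p (q - 1)
        rw [Nat.cast_succ, ← add_assoc] at h2
        rw [h2, ihn (p + 1) _ (by push_cast at hp; linarith), sub_add_cancel, zero_sub,
          eq_comm, neg_eq_zero] at h1
        exact h1
    exact key (P - p).toNat p q (by omega)

/-- The coefficient of `z^j y^{-q₀-1}` in the series `x^{p₀} ∑ G p q x^{-p-1} y^{-q-1}` with
`x = y + z` substituted, expanded in nonnegative powers of `z`. It is meant for families `G` which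
vanish for large `p` and for large `q`, so that the sum is finite. -/
noncomputable def substSum (G : ℤ → ℤ → M) (j : ℕ) (p₀ q₀ : ℤ) : M :=
  ∑ᶠ p : ℤ, Ring.choose (-p - 1) j • G (p + p₀) (q₀ - 1 - j - p)

theorem substSum_finite_support {G : ℤ → ℤ → M} {N : ℤ} (hG : ∀ p q, N ≤ p ∨ N ≤ q → G p q = 0)
    (c : ℤ → ℤ) (p₀ q₀ : ℤ) : (Function.support fun p : ℤ => c p • G (p + p₀) (q₀ - p)).Finite := by
  refine (Set.finite_Icc (q₀ - N) (N - p₀)).subset fun p hp => ?_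
  by_contra hcon
  refine hp ?_
  rw [Set.mem_Icc, not_and_or, not_le, not_le] at hcon
  dsimp only
  rw [hG _ _ (by omega), smul_zero]

theorem substSum_shift (G : ℤ → ℤ → M) (j : ℕ) (p₀ q₀ : ℤ) :
    substSum G j (p₀ + 1) q₀
      = ∑ᶠ p : ℤ, Ring.choose (-p - 1 + 1) j • G (p + p₀) (q₀ - j - p) := by
  rw [← finsum_comp_equiv (Equiv.addRight (1 : ℤ))]
  refine finsum_congr fun p => ?_
  rw [Equiv.coe_addRight, show -(p + 1) - 1 + 1 = -p - 1 by ring,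
    show p + 1 + p₀ = p + (p₀ + 1) by ring, show q₀ - j - (p + 1) = q₀ - 1 - j - p by ring]

theorem substSum_zero_succ (G : ℤ → ℤ → M) (p₀ q₀ : ℤ) :
    substSum G 0 (p₀ + 1) q₀ = substSum G 0 p₀ (q₀ + 1) := by
  rw [substSum_shift]
  refine finsum_congr fun p => ?_
  rw [Ring.choose_zero_right, Ring.choose_zero_right, add_sub_cancel_right]

theorem substSum_succ {G : ℤ → ℤ → M} {N : ℤ} (hG : ∀ p q, N ≤ p ∨ N ≤ q → G p q = 0) (j : ℕ)
    (p₀ q₀ : ℤ) :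
    substSum G (j + 1) (p₀ + 1) q₀ = substSum G j p₀ q₀ + substSum G (j + 1) p₀ (q₀ + 1) := by
  have h1 := substSum_finite_support hG (fun p => Ring.choose (-p - 1) j) p₀ (q₀ - 1 - j)
  have h2 := substSum_finite_support hG (fun p => Ring.choose (-p - 1) (j + 1)) p₀
    (q₀ + 1 - 1 - (j + 1 : ℕ))
  rw [substSum_shift, substSum, substSum, ← finsum_add_distrib h1 h2]
  refine finsum_congr fun p => ?_
  rw [Ring.choose_succ_succ, add_smul, add_sub_cancel_right,
    show q₀ - (j + 1 : ℕ) - p = q₀ - 1 - j - p by push_cast; ring]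

/-- Division by `(x - y)^{j+1}`: multiplication by `∑ i, (i choose j) x^{-1-i} y^{i-j}`. -/
theorem binExp_sub_one_sub {φ : ℤ → ℤ → M} (hφ : LowerTruncated φ) (k : ℤ) (j : ℕ) (p q : ℤ) :
    binExp (k - 1 - j) φ p q
      = ∑ᶠ i : ℕ, Ring.choose (i : ℤ) j • binExp k φ (p - 1 - i) (q - j + i) := by
  obtain ⟨Q, hQ⟩ := binExp_lowerTruncated hφ k
  set S : ℕ → ℤ → ℤ → M := fun j p q =>
    ∑ᶠ i : ℕ, Ring.choose (i : ℤ) j • binExp k φ (p - 1 - i) (q - j + i) with hS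
  have hT : ∀ j, LowerTruncated (S j) := fun j =>
    ⟨Q + j, fun q hq p => finsum_eq_zero_of_forall_eq_zero fun i => by
      rw [hQ _ (by omega), smul_zero]⟩
  have hshift : ∀ j p q, S j (p + 1) q = Ring.choose (0 : ℤ) j • binExp k φ p (q - j)
      + ∑ᶠ i : ℕ, Ring.choose ((i : ℤ) + 1) j • binExp k φ (p - 1 - i) (q + 1 - j + i) := by
    intro j p q
    simp only [hS]
    rw [finsum_eq_zero_add (Q - (q - j)).toNat (fun i hi => by rw [hQ _ (by omega), smul_zero]),
      Nat.cast_zero, sub_zero, add_zero, add_sub_cancel_right]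
    congr 1
    refine finsum_congr fun i => ?_
    rw [Nat.cast_succ, show p - ((i : ℤ) + 1) = p - 1 - i by ring,
      show q - j + ((i : ℤ) + 1) = q + 1 - j + i by ring]
  change _ = S j p q
  -- both sides obey the same recursion in `j`
  induction j generalizing p q with
  | zero =>
    refine eq_of_sub_shift_eq (binExp_lowerTruncated hφ _) (hT 0) (fun p q => ?_) p q
    rw [← binExp_succ hφ, hshift]
    simp [hS]
  | succ j ih =>
    refine eq_of_sub_shift_eq (binExp_lowerTruncated hφ _) (hT (j + 1)) (fun p q => ?_) p q
    have hfin : ∀ (c : ℕ → ℤ) (u : ℕ → ℤ) (q : ℤ),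
        (Function.support fun i : ℕ => c i • binExp k φ (u i) (q + i)).Finite :=
      (binExp_lowerTruncated hφ k).finite_support
    rw [← binExp_succ hφ, show k - 1 - (j + 1 : ℕ) + 1 = k - 1 - (j : ℤ) by push_cast; ring, ih,
      hshift, Ring.choose_zero_succ, zero_smul, zero_add]
    simp only [Ring.choose_succ_succ, add_smul, hS]
    rw [finsum_add_distrib (hfin _ _ _) (hfin _ _ _), add_sub_cancel_right]
    refine finsum_congr fun i => ?_
    rw [show q + 1 - (j + 1 : ℕ) + (i : ℤ) = q - j + i by push_cast; ring]

/-- If `(x - y)^k φ = (-y + x)^k ψ`, and this series has finitely many negative powers of `x` and of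
`y`, then the residue in `x` of `(x - y)^{k-1-j} φ - (-y + x)^{k-1-j} ψ` is the coefficient of `z^j`
in the common series at `x = y + z`. The case of general `p` enters the induction. -/
theorem borcherdsDiff_eq_substSum {φ ψ : ℤ → ℤ → M} (hφ : LowerTruncated φ)
    (hψ : LowerTruncated ψ) {k N : ℤ} (hk : ∀ p q, borcherdsDiff φ ψ k p q = 0)
    (hG : ∀ p q, N ≤ p ∨ N ≤ q → binExp k φ p q = 0) (j : ℕ) (p q : ℤ) :
    borcherdsDiff φ ψ (k - 1 - j) p q = substSum (binExp k φ) j p q := by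
  obtain ⟨P, hP⟩ := hψ
  -- the part with `ψ` does not contribute for large `p`
  have hlarge : ∀ j : ℕ, ∀ p, N ⊔ P ≤ p → ∀ q,
      borcherdsDiff φ ψ (k - 1 - j) p q = substSum (binExp k φ) j p q := by
    intro j p hp q
    rw [borcherdsDiff, binExp_eq_zero (φ := ψ) (fun q i => hP _ (by omega) q), smul_zero, sub_zero,
      binExp_sub_one_sub hφ, substSum]
    have hinj : Function.Injective fun i : ℕ => (-1 - i : ℤ) := fun i i' h => by
      simpa using h
    have hsupp : (Function.support fun p' : ℤ =>
        Ring.choose (-p' - 1) j • binExp k φ (p' + p) (q - 1 - j - p'))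
        ⊆ Set.range fun i : ℕ => (-1 - i : ℤ) := by
      intro p' hp'
      by_contra hcon
      refine hp' ?_
      have : 0 ≤ p' := by
        by_contra h
        exact hcon ⟨(-1 - p').toNat, by dsimp only; omega⟩
      dsimp only
      rw [hG _ _ (Or.inl (by omega)), smul_zero]
    rw [← finsum_mem_univ, ← finsum_mem_univ (f := fun p' : ℤ => _ • _),
      ← finsum_mem_inter_support_eq' _ (Set.range fun i : ℕ => (-1 - i : ℤ)) Set.univ
        (fun x hx => by simp [hsupp hx]), finsum_mem_range hinj, finsum_mem_univ]
    refine finsum_congr fun i => ?_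
    rw [show -(-1 - (i : ℤ)) - 1 = i by ring, show -1 - (i : ℤ) + p = p - 1 - i by ring,
      show q - 1 - j - (-1 - (i : ℤ)) = q - j + i by ring]
  have descend : ∀ j : ℕ, (∀ p q, borcherdsDiff φ ψ (k - 1 - j) (p + 1) q
      - substSum (binExp k φ) j (p + 1) q = borcherdsDiff φ ψ (k - 1 - j) p (q + 1)
      - substSum (binExp k φ) j p (q + 1)) → ∀ p q,
      borcherdsDiff φ ψ (k - 1 - j) p q = substSum (binExp k φ) j p q := by
    intro j hj
    have key : ∀ n : ℕ, ∀ p q, N ⊔ P ≤ p + n →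
        borcherdsDiff φ ψ (k - 1 - j) p q = substSum (binExp k φ) j p q := by
      intro n
      induction n with
      | zero => exact fun p q hp => hlarge j p (by simpa using hp) q
      | succ n ihn =>
        intro p q hp
        have h1 := hj p (q - 1)
        rw [ihn (p + 1) _ (by push_cast at hp; linarith), sub_self, sub_add_cancel] at h1
        exact (sub_eq_zero.1 h1.symm)
    exact fun p q => key (N ⊔ P - p).toNat p q (by omega)
  induction j generalizing p q with
  | zero =>
    refine descend 0 (fun p q => ?_) p q
    have h1 := borcherdsDiff_succ hφ ⟨P, hP⟩ (k - 1) p q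
    rw [sub_add_cancel, hk, eq_comm, sub_eq_zero] at h1
    rw [Nat.cast_zero, sub_zero, h1, substSum_zero_succ]
  | succ j ih =>
    refine descend (j + 1) (fun p q => ?_) p q
    have h1 := borcherdsDiff_succ hφ ⟨P, hP⟩ (k - 1 - (j + 1 : ℕ)) p q
    rw [show k - 1 - (j + 1 : ℕ) + 1 = k - 1 - (j : ℤ) by push_cast; ring, ih] at h1
    rw [substSum_succ hG, h1]
    abel

end Substitution

/-! ### Rows, residue products and the operation `comp` -/

section ResidueProduct

open OneVarField

variable {r : ℕ} {W : Type*} [AddCommGroup W] [Module ℂ W]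

/-- The coefficient of `x^{-m}` in `a(x₀, x)`, a field in the variable `x₀`. -/
def VertexOps.row (a : VertexOps r W) (m : Fin r → ℤ) : OneVarField W where
  toFun p := a.coeff p m
  truncated w := (a.truncated w).imp fun _ hN p hp => hN p hp m

theorem VertexOps.row_apply (a : VertexOps r W) (m : Fin r → ℤ) (p : ℤ) (w : W) :
    a.row m p w = a.coeff p m w := rfl

/-- The product `a_{n,m} b` given by residues. It is defined for all pairs, and agrees with `comp`
for mutually local ones. -/
noncomputable def resProd (a b : VertexOps r W) (n : ℤ) (m : Fin r → ℤ) : VertexOps r W where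
  coeff s t := prod (a.row m) (b.row (t - m)) n s
  truncated w := by
    obtain ⟨S, hS⟩ := exists_commDiff_family_eq_zero (a.row m) b.row
      (fun w => b.truncated w) w n 0
    exact ⟨S, fun s hs t => hS s hs (t - m)⟩

theorem resProd_coeff (a b : VertexOps r W) (n : ℤ) (m : Fin r → ℤ) (s : ℤ) (t : Fin r → ℤ)
    (w : W) : (resProd a b n m).coeff s t w = commDiff (a.row m) (b.row (t - m)) w n 0 s := rfl

/-- All rows of `a` and `b` are mutually local of order `k`. -/
def RowsLocal (k : ℕ) (a b : VertexOps r W) : Prop :=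
  ∀ m n, LocalOfOrder k (a.row m) (b.row n)

theorem RowsLocal.mono {k l : ℕ} {a b : VertexOps r W} (h : RowsLocal k a b) (hl : k ≤ l) :
    RowsLocal l a b := fun m n => (h m n).mono hl

theorem RowsLocal.symm {k : ℕ} {a b : VertexOps r W} (h : RowsLocal k a b) : RowsLocal k b a :=
  fun m n => (h n m).symm

theorem binExp_natCast {M : Type*} [AddCommGroup M] (k : ℕ) (φ : ℤ → ℤ → M) (p q : ℤ) :
    binExp k φ p q
      = ∑ i ∈ Finset.range (k + 1), ((-1 : ℤ) ^ i * (k.choose i : ℤ)) • φ (p + k - i) (q + i) := by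
  rw [binExp, finsum_eq_sum_range (k + 1)]
  · simp only [Ring.choose_natCast]
  · intro i hi
    rw [Ring.choose_natCast, Nat.choose_eq_zero_of_lt (by omega), Nat.cast_zero, mul_zero,
      zero_smul]

theorem subPow_mulXY_apply (k : ℕ) (a b : VertexOps r W) (p : ℤ) (m : Fin r → ℤ) (q : ℤ)
    (n : Fin r → ℤ) (w : W) :
    subPow k (mulXY a.coeff b.coeff) p m q n w
      = binExp k (word (a.row m) (b.row n) w) p q := by
  rw [binExp_natCast, subPow, LinearMap.sum_apply]
  rfl

theorem subPow_mulYX_apply (k : ℕ) (a b : VertexOps r W) (p : ℤ) (m : Fin r → ℤ) (q : ℤ)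
    (n : Fin r → ℤ) (w : W) :
    subPow k (mulYX a.coeff b.coeff) p m q n w
      = ((k : ℤ).negOnePow : ℤ) • binExp k (word (b.row n) (a.row m) w) q p := by
  rw [binExp_natCast, subPow, LinearMap.sum_apply, ← Finset.sum_flip, Finset.smul_sum]
  refine Finset.sum_congr rfl fun i hi => ?_
  have hik : i ≤ k := by simpa [Nat.lt_succ_iff] using hi
  rw [smul_smul, Int.coe_negOnePow_natCast, ← mul_assoc, Nat.choose_symm hik, Nat.cast_sub hik]
  have hsign : (-1 : ℤ) ^ (k - i) = (-1) ^ k * (-1) ^ i := by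
    obtain ⟨d, rfl⟩ := Nat.exists_eq_add_of_le hik
    rw [Nat.add_sub_cancel_left, pow_add, mul_right_comm, ← pow_add, ← two_mul, pow_mul]
    simp
  rw [hsign]
  rw [LinearMap.smul_apply]
  refine congrArg _ ?_
  change b.coeff (q + (k - i : ℤ)) n (a.coeff (p + k - (k - i : ℤ)) m w)
    = b.coeff (q + k - i) n (a.coeff (p + i) m w)
  rw [show p + k - ((k : ℤ) - i) = p + i by ring, show q + ((k : ℤ) - i) = q + k - i by ring]

theorem commDiff_eq_subPow (k : ℕ) (a b : VertexOps r W) (p : ℤ) (m : Fin r → ℤ) (q : ℤ)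
    (n : Fin r → ℤ) (w : W) :
    commDiff (a.row m) (b.row n) w k p q
      = subPow k (mulXY a.coeff b.coeff) p m q n w
        - subPow k (mulYX a.coeff b.coeff) p m q n w := by
  rw [subPow_mulXY_apply, subPow_mulYX_apply]
  rfl

theorem mutuallyLocal_iff {a b : VertexOps r W} :
    MutuallyLocal a.coeff b.coeff ↔ ∃ k, RowsLocal k a b := by
  refine exists_congr fun k => ⟨fun h m n w p q => ?_, fun h => ?_⟩
  · rw [commDiff_eq_subPow, h, sub_self]
  · funext p m q n
    refine LinearMap.ext fun w => ?_
    rw [← sub_eq_zero, ← commDiff_eq_subPow, h m n]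

theorem RowsLocal.compatible {k : ℕ} {a b : VertexOps r W} (h : RowsLocal k a b) :
    Compatible a b := by
  refine ⟨k, fun w => ?_⟩
  obtain ⟨M, hM⟩ := a.truncated w
  obtain ⟨N, hN⟩ := b.truncated w
  refine ⟨M ⊔ N, fun p m q n hpq => ?_⟩
  rcases hpq with hp | hq
  · have h1 := h m n w p q
    rw [commDiff_eq_subPow, sub_eq_zero] at h1
    rw [h1, subPow_mulYX_apply, binExp_eq_zero, smul_zero]
    intro q i
    rw [word, VertexOps.row_apply a, hM _ (by omega), map_zero]
  · rw [subPow_mulXY_apply]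
    refine binExp_eq_zero (fun p i => ?_) _ _
    rw [word, VertexOps.row_apply b, hN _ (by omega), map_zero]

/-- If `(x₀ - y₀)^k a(x₀, x) b(y₀, y)` involves finitely many negative powers, then `k` is an order
of locality for the mutually local pair `(a, b)`. -/
theorem RowsLocal.of_isLaurent₂ {j : ℕ} {a b : VertexOps r W} (h : RowsLocal j a b) {k : ℕ}
    (hk : IsLaurent₂ (subPow k (mulXY a.coeff b.coeff))) : RowsLocal k a b := by
  intro m n w
  obtain ⟨N, hN⟩ := hk w
  obtain ⟨M, hM⟩ := a.truncated w
  refine eq_zero_of_recursion (commDiff_succ (a.row m) (b.row n) w) (P := M ⊔ N)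
    (fun p hp q => ?_) j (fun p q => (h m n).commDiff_eq_zero (by omega) w p q)
  rw [commDiff_eq_subPow, hN p m q n (Or.inl (le_trans le_sup_right hp)), subPow_mulYX_apply,
    binExp_eq_zero, smul_zero, sub_zero]
  intro q i
  have : M ≤ p := le_trans le_sup_left hp
  rw [word, VertexOps.row_apply a, hM _ (by omega), map_zero]

/-- On mutually local pairs, the operation `comp`, defined by the substitution
`x₀ = y₀ + z₀`, is the residue product. -/
theorem comp_eq_resProd {j : ℕ} {a b : VertexOps r W} (h : RowsLocal j a b) (hab : Compatible a b)
    (n : ℤ) (m : Fin r → ℤ) : comp a b hab n m = resProd a b n m := by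
  refine VertexOps.ext_coeff fun s t w => ?_
  have hloc := h.of_isLaurent₂ hab.choose_spec
  obtain ⟨N, hN⟩ := hab.choose_spec w
  rw [resProd_coeff]
  by_cases hn : n < hab.choose
  · have h1 : (comp a b hab n m).coeff s t = substCoeff (subPow hab.choose
        (mulXY a.coeff b.coeff)) hab.choose_spec ((hab.choose : ℤ) - 1 - n).toNat m s t :=
      if_pos hn
    have h2 := borcherdsDiff_eq_substSum (word_lowerTruncated (a.row m) (b.row (t - m)) w)
      (word_lowerTruncated (b.row (t - m)) (a.row m) w) (hloc m (t - m) w) (N := N)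
      (fun p q hpq => by rw [← subPow_mulXY_apply]; exact hN p m q (t - m) hpq)
      ((hab.choose : ℤ) - 1 - n).toNat 0 s
    rw [show (hab.choose : ℤ) - 1 - (((hab.choose : ℤ) - 1 - n).toNat : ℤ) = n by omega] at h2
    rw [h1]
    refine Eq.trans ?_ h2.symm
    refine finsum_congr fun p => ?_
    rw [subPow_mulXY_apply, add_zero]
  · have h1 : (comp a b hab n m).coeff s t = 0 := if_neg hn
    rw [h1, (hloc m (t - m)).commDiff_eq_zero (by omega)]
    rfl

theorem RowsLocal.resProd_eq_zero {k : ℕ} {a b : VertexOps r W} (h : RowsLocal k a b) {n : ℤ}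
    (hn : k ≤ n) (m : Fin r → ℤ) : resProd a b n m = 0 :=
  VertexOps.ext_coeff fun s t w => (h m (t - m)).commDiff_eq_zero hn w 0 s

/-- Dong's lemma for toroidal fields. -/
theorem RowsLocal.resProd {k : ℕ} {a b c : VertexOps r W} (hab : RowsLocal k a b)
    (hbc : RowsLocal k b c) (hac : RowsLocal k a c) (n : ℤ) (m : Fin r → ℤ) :
    RowsLocal (k + (k - n).toNat + k) (resProd a b n m) c :=
  fun t t' => (hab m (t - m)).prod (hbc _ t') (hac m t') n

/-! ### Linearity of the residue product -/

theorem commDiff_add_left {f f' f'' : OneVarField W} (g : OneVarField W)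
    (h : ∀ p w, f'' p w = f p w + f' p w) (w : W) (l p q : ℤ) :
    commDiff f'' g w l p q = commDiff f g w l p q + commDiff f' g w l p q := by
  have h1 : word f'' g w = fun p q => word f g w p q + word f' g w p q := by
    funext p q; simp [word, h]
  have h2 : word g f'' w = fun p q => word g f w p q + word g f' w p q := by
    funext p q; simp [word, h]
  rw [commDiff, h1, h2]
  exact borcherdsDiff_add (word_lowerTruncated f g w) (word_lowerTruncated g f w)
    (word_lowerTruncated f' g w) (word_lowerTruncated g f' w) l p q

theorem commDiff_add_right {g g' g'' : OneVarField W} (f : OneVarField W)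
    (h : ∀ p w, g'' p w = g p w + g' p w) (w : W) (l p q : ℤ) :
    commDiff f g'' w l p q = commDiff f g w l p q + commDiff f g' w l p q := by
  have h1 : word f g'' w = fun p q => word f g w p q + word f g' w p q := by
    funext p q; simp [word, h]
  have h2 : word g'' f w = fun p q => word g f w p q + word g' f w p q := by
    funext p q; simp [word, h]
  rw [commDiff, h1, h2]
  exact borcherdsDiff_add (word_lowerTruncated f g w) (word_lowerTruncated g f w)
    (word_lowerTruncated f g' w) (word_lowerTruncated g' f w) l p q

theorem commDiff_smul_left {f f' : OneVarField W} (g : OneVarField W) (c : ℂ)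
    (h : ∀ p w, f' p w = c • f p w) (w : W) (l p q : ℤ) :
    commDiff f' g w l p q = c • commDiff f g w l p q := by
  have h1 : word f' g w = fun p q => c • word f g w p q := by
    funext p q; simp [word, h]
  have h2 : word g f' w = fun p q => c • word g f w p q := by
    funext p q; simp [word, h]
  rw [commDiff, h1, h2]
  exact (map_borcherdsDiff (word_lowerTruncated f g w) (word_lowerTruncated g f w)
    (DistribSMul.toAddMonoidHom W c) l p q).symm

theorem commDiff_smul_right {g g' : OneVarField W} (f : OneVarField W) (c : ℂ)
    (h : ∀ p w, g' p w = c • g p w) (w : W) (l p q : ℤ) :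
    commDiff f g' w l p q = c • commDiff f g w l p q := by
  have h1 : word f g' w = fun p q => c • word f g w p q := by
    funext p q; simp [word, h]
  have h2 : word g' f w = fun p q => c • word g f w p q := by
    funext p q; simp [word, h]
  rw [commDiff, h1, h2]
  exact (map_borcherdsDiff (word_lowerTruncated f g w) (word_lowerTruncated g f w)
    (DistribSMul.toAddMonoidHom W c) l p q).symm

theorem resProd_add_left (a a' b : VertexOps r W) (n : ℤ) (m : Fin r → ℤ) :
    resProd (a + a') b n m = resProd a b n m + resProd a' b n m :=
  VertexOps.ext_coeff fun s t w =>
    commDiff_add_left (b.row (t - m)) (f := a.row m) (f' := a'.row m) (fun _ _ => rfl) w n 0 s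

theorem resProd_add_right (a b b' : VertexOps r W) (n : ℤ) (m : Fin r → ℤ) :
    resProd a (b + b') n m = resProd a b n m + resProd a b' n m :=
  VertexOps.ext_coeff fun s t w =>
    commDiff_add_right (a.row m) (g := b.row (t - m)) (g' := b'.row (t - m))
      (fun _ _ => rfl) w n 0 s

theorem resProd_smul_left (c : ℂ) (a b : VertexOps r W) (n : ℤ) (m : Fin r → ℤ) :
    resProd (c • a) b n m = c • resProd a b n m :=
  VertexOps.ext_coeff fun s t w =>
    commDiff_smul_left (b.row (t - m)) (f := a.row m) c (fun _ _ => rfl) w n 0 s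

theorem resProd_smul_right (c : ℂ) (a b : VertexOps r W) (n : ℤ) (m : Fin r → ℤ) :
    resProd a (c • b) n m = c • resProd a b n m :=
  VertexOps.ext_coeff fun s t w =>
    commDiff_smul_right (a.row m) (g := b.row (t - m)) c (fun _ _ => rfl) w n 0 s

theorem resProd_zero_left (b : VertexOps r W) (n : ℤ) (m : Fin r → ℤ) :
    resProd 0 b n m = 0 := by
  simpa using resProd_smul_left 0 0 b n m

theorem resProd_zero_right (a : VertexOps r W) (n : ℤ) (m : Fin r → ℤ) :
    resProd a 0 n m = 0 := by
  simpa using resProd_smul_right 0 a 0 n m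

/-- The fields which are mutually local with `b` form a subspace. -/
def localSubmodule (b : VertexOps r W) : Submodule ℂ (VertexOps r W) where
  carrier := {a | ∃ k, RowsLocal k a b}
  zero_mem' := ⟨0, fun m n w p q => by
    rw [commDiff_smul_left (f := (0 : VertexOps r W).row m) (b.row n) 0
      (fun p w => (zero_smul ℂ _).symm), zero_smul]⟩
  add_mem' := by
    rintro a a' ⟨k, hk⟩ ⟨k', hk'⟩
    refine ⟨k ⊔ k', fun m n w p q => ?_⟩
    rw [commDiff_add_left (f := a.row m) (f' := a'.row m) (b.row n) (fun _ _ => rfl),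
      hk.mono le_sup_left m n, hk'.mono le_sup_right m n, add_zero]
  smul_mem' := by
    rintro c a ⟨k, hk⟩
    refine ⟨k, fun m n w p q => ?_⟩
    rw [commDiff_smul_left (f := a.row m) (b.row n) c (fun _ _ => rfl), hk m n, smul_zero]

theorem mem_localSubmodule_comm {a b : VertexOps r W} (h : a ∈ localSubmodule b) :
    b ∈ localSubmodule a := h.imp fun _ hk => hk.symm

theorem exists_common_order {a b c : VertexOps r W} (hab : a ∈ localSubmodule b)
    (hbc : b ∈ localSubmodule c) (hac : a ∈ localSubmodule c) :
    ∃ k, RowsLocal k a b ∧ RowsLocal k b c ∧ RowsLocal k a c := by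
  obtain ⟨k₁, h₁⟩ := hab
  obtain ⟨k₂, h₂⟩ := hbc
  obtain ⟨k₃, h₃⟩ := hac
  exact ⟨k₁ ⊔ k₂ ⊔ k₃, h₁.mono (le_trans le_sup_left le_sup_left),
    h₂.mono (le_trans le_sup_right le_sup_left), h₃.mono le_sup_right⟩

theorem resProd_mem_localSubmodule {a b c : VertexOps r W} (hab : a ∈ localSubmodule b)
    (hbc : b ∈ localSubmodule c) (hac : a ∈ localSubmodule c) (n : ℤ) (m : Fin r → ℤ) :
    resProd a b n m ∈ localSubmodule c := by
  obtain ⟨k, h₁, h₂, h₃⟩ := exists_common_order hab hbc hac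
  exact ⟨_, h₁.resProd h₂ h₃ n m⟩

/-! ### The identity field -/

theorem rowsLocal_oneOp (b : VertexOps r W) : RowsLocal 0 (oneOp r W) b := by
  intro m n w p q
  rw [Nat.cast_zero, commDiff_zero, VertexOps.row_apply, VertexOps.row_apply]
  by_cases h : p = -1 ∧ m = 0 <;> simp [oneOp, h, VertexOps.row]

theorem oneOp_mem_localSubmodule (b : VertexOps r W) : oneOp r W ∈ localSubmodule b :=
  ⟨0, rowsLocal_oneOp b⟩

theorem resProd_oneOp_left (b : VertexOps r W) (n : ℤ) (m : Fin r → ℤ) :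
    resProd (oneOp r W) b n m = if n = -1 ∧ m = 0 then b else 0 := by
  refine VertexOps.ext_coeff fun s t w => ?_
  rw [resProd_coeff, commDiff_eq_binExp (a := 0) (fun p hp => by
    simp [oneOp, VertexOps.row, show p ≠ -1 by omega])]
  have hrow : ∀ p v, (oneOp r W).row m p v = if p = -1 ∧ m = 0 then v else 0 := by
    intro p v
    by_cases h : p = -1 ∧ m = 0 <;> simp [oneOp, h, VertexOps.row]
  by_cases h : n = -1 ∧ m = 0
  · obtain ⟨rfl, rfl⟩ := h
    rw [binExp, finsum_eq_single _ 0]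
    · simp [word, hrow, VertexOps.row_apply]
    · intro i hi
      rw [word, hrow, if_neg (by omega), smul_zero]
  · rw [if_neg h]
    by_cases hn : 0 ≤ n
    · -- only the mode `-1` of `1_W` can contribute, with the coefficient `Ring.choose n (n + 1)`,
      -- which vanishes
      have := (rowsLocal_oneOp b m (t - m)).commDiff_eq_zero (l := n) (by simpa using hn) w 0 s
      rwa [commDiff_eq_binExp (a := 0) (fun p hp => by
        simp [oneOp, VertexOps.row, show p ≠ -1 by omega])] at this
    · refine finsum_eq_zero_of_forall_eq_zero fun i => ?_
      rw [word, hrow, if_neg (fun h' => h ⟨by omega, h'.2⟩), smul_zero]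

theorem resProd_oneOp_right (a : VertexOps r W) {n : ℤ} (hn : 0 ≤ n) (m : Fin r → ℤ) :
    resProd a (oneOp r W) n m = 0 :=
  (rowsLocal_oneOp a).symm.resProd_eq_zero (by simpa using hn) m

end ResidueProduct

/-! ### Derivations of the residue product -/

section Derivations

open OneVarField

theorem binExp_deriv_left {M : Type*} [AddCommGroup M] {φ φ' : ℤ → ℤ → M} (hφ : LowerTruncated φ)
    (h : ∀ p q, φ' p q = (-p) • φ (p - 1) q) (l p q : ℤ) :
    binExp l φ' p q = (-p) • binExp l φ (p - 1) q - l • binExp (l - 1) φ p q := by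
  refine Eq.trans ?_ (eq_binExp_of_recursion
    (L := fun l p q => (-p) • binExp l φ (p - 1) q - l • binExp (l - 1) φ p q)
    (fun l p q => ?_) (fun l => ?_) l p q).symm
  · refine binExp_congr (fun p i => ?_) l p
    rw [h, binExp_zero, zero_smul, sub_zero]
  · have h1 := binExp_succ hφ l (p - 1) q
    have h2 := binExp_succ hφ (l - 1) p q
    rw [sub_add_cancel] at h1 h2
    rw [add_sub_cancel_right, add_sub_cancel_right, h1]
    have h3 : binExp (l - 1) φ (p + 1) q = binExp l φ p q + binExp (l - 1) φ p (q + 1) := by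
      rw [h2, sub_add_cancel]
    rw [h3]
    module
  · obtain ⟨Q, hQ⟩ := binExp_lowerTruncated hφ l
    obtain ⟨R, hR⟩ := binExp_lowerTruncated hφ (l - 1)
    refine ⟨Q ⊔ R, fun q hq p => ?_⟩
    dsimp only
    rw [hQ q (le_trans le_sup_left hq), hR q (le_trans le_sup_right hq), smul_zero, smul_zero,
      sub_zero]

theorem binExp_deriv_right {M : Type*} [AddCommGroup M] {φ φ' : ℤ → ℤ → M} (hφ : LowerTruncated φ)
    (h : ∀ p q, φ' p q = (-q) • φ p (q - 1)) (l p q : ℤ) :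
    binExp l φ' p q = (-q) • binExp l φ p (q - 1) + l • binExp (l - 1) φ p q := by
  refine Eq.trans ?_ (eq_binExp_of_recursion
    (L := fun l p q => (-q) • binExp l φ p (q - 1) + l • binExp (l - 1) φ p q)
    (fun l p q => ?_) (fun l => ?_) l p q).symm
  · refine binExp_congr (fun p i => ?_) l p
    rw [h, binExp_zero, zero_smul, add_zero]
  · have h1 := binExp_succ hφ l p (q - 1)
    have h2 := binExp_succ hφ (l - 1) p q
    rw [sub_add_cancel] at h1 h2
    rw [add_sub_cancel_right, add_sub_cancel_right, h1]
    have h3 : binExp (l - 1) φ (p + 1) q = binExp l φ p q + binExp (l - 1) φ p (q + 1) := by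
      rw [h2, sub_add_cancel]
    rw [h3]
    module
  · obtain ⟨Q, hQ⟩ := binExp_lowerTruncated hφ l
    obtain ⟨R, hR⟩ := binExp_lowerTruncated hφ (l - 1)
    refine ⟨(Q + 1) ⊔ R, fun q hq p => ?_⟩
    have hq1 : Q + 1 ≤ q := le_trans le_sup_left hq
    dsimp only
    rw [hQ (q - 1) (by omega), hR q (le_trans le_sup_right hq), smul_zero, smul_zero, add_zero]

variable {r : ℕ} {W : Type*} [AddCommGroup W] [Module ℂ W]

theorem commDiff_deriv_left {f f' : OneVarField W} (g : OneVarField W)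
    (h : ∀ p w, f' p w = (-p) • f (p - 1) w) (w : W) (l p q : ℤ) :
    commDiff f' g w l p q = (-p) • commDiff f g w l (p - 1) q - l • commDiff f g w (l - 1) p q := by
  simp only [commDiff, borcherdsDiff]
  rw [binExp_deriv_left (φ' := word f' g w) (word_lowerTruncated f g w) (fun p q => h p _),
    binExp_deriv_right (φ' := word g f' w) (word_lowerTruncated g f w)
      (fun q p => by rw [word, word, h, map_zsmul]), Int.negOnePow_sub, Int.negOnePow_one]
  push_cast
  module

theorem commDiff_deriv_right {g g' : OneVarField W} (f : OneVarField W)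
    (h : ∀ p w, g' p w = (-p) • g (p - 1) w) (w : W) (l p q : ℤ) :
    commDiff f g' w l p q = (-q) • commDiff f g w l p (q - 1) + l • commDiff f g w (l - 1) p q := by
  simp only [commDiff, borcherdsDiff]
  rw [binExp_deriv_left (φ' := word g' f w) (word_lowerTruncated g f w) (fun p q => h p _),
    binExp_deriv_right (φ' := word f g' w) (word_lowerTruncated f g w)
      (fun q p => by rw [word, word, h, map_zsmul]), Int.negOnePow_sub, Int.negOnePow_one]
  push_cast
  module

theorem derivZero_coeff (a : VertexOps r W) (p : ℤ) (m : Fin r → ℤ) (w : W) :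
    (derivZero r W a).coeff p m w = (-(p : ℂ)) • a.coeff (p - 1) m w := rfl

theorem eulerOp_coeff (j : Fin r) (a : VertexOps r W) (p : ℤ) (m : Fin r → ℤ) (w : W) :
    (eulerOp r W j a).coeff p m w = (-(m j : ℂ)) • a.coeff p m w := rfl

theorem derivZero_row (a : VertexOps r W) (m : Fin r → ℤ) (p : ℤ) (w : W) :
    (derivZero r W a).row m p w = (-p) • a.row m (p - 1) w := by
  rw [← Int.cast_smul_eq_zsmul ℂ, Int.cast_neg]
  rfl

theorem eulerOp_row (j : Fin r) (a : VertexOps r W) (m : Fin r → ℤ) (p : ℤ) (w : W) :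
    (eulerOp r W j a).row m p w = (-(m j : ℂ)) • a.row m p w := rfl

theorem resProd_derivZero_left (a b : VertexOps r W) (n : ℤ) (m : Fin r → ℤ) :
    resProd (derivZero r W a) b n m = (-(n : ℂ)) • resProd a b (n - 1) m := by
  refine VertexOps.ext_coeff fun s t w => ?_
  rw [VertexOps.coeff_smul, LinearMap.smul_apply, resProd_coeff, resProd_coeff,
    commDiff_deriv_left _ (derivZero_row a m), neg_zero, zero_smul, zero_sub, neg_smul,
    Int.cast_smul_eq_zsmul]

theorem derivZero_resProd (a b : VertexOps r W) (n : ℤ) (m : Fin r → ℤ) :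
    derivZero r W (resProd a b n m)
      = resProd (derivZero r W a) b n m + resProd a (derivZero r W b) n m := by
  refine VertexOps.ext_coeff fun s t w => ?_
  rw [derivZero_coeff, VertexOps.coeff_add, LinearMap.add_apply]
  simp only [resProd_coeff]
  rw [commDiff_deriv_left _ (derivZero_row a m), commDiff_deriv_right _ (derivZero_row b (t - m)),
    neg_zero, zero_smul, zero_sub, neg_smul, neg_smul, Int.cast_smul_eq_zsmul]
  abel

theorem resProd_eulerOp_left (j : Fin r) (a b : VertexOps r W) (n : ℤ) (m : Fin r → ℤ) :
    resProd (eulerOp r W j a) b n m = (-(m j : ℂ)) • resProd a b n m :=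
  VertexOps.ext_coeff fun s t w =>
    commDiff_smul_left (b.row (t - m)) _ (eulerOp_row j a m) w n 0 s

theorem eulerOp_resProd (j : Fin r) (a b : VertexOps r W) (n : ℤ) (m : Fin r → ℤ) :
    eulerOp r W j (resProd a b n m)
      = resProd (eulerOp r W j a) b n m + resProd a (eulerOp r W j b) n m := by
  refine VertexOps.ext_coeff fun s t w => ?_
  rw [eulerOp_coeff, VertexOps.coeff_add, LinearMap.add_apply]
  simp only [resProd_coeff]
  rw [commDiff_smul_left (b.row (t - m)) _ (eulerOp_row j a m),
    commDiff_smul_right (a.row m) _ (eulerOp_row j b (t - m)),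
    ← add_smul, Pi.sub_apply]
  congr 1
  push_cast
  ring

theorem diffOp_zero : diffOp r W 0 = derivZero r W := rfl

theorem diffOp_succ (j : Fin r) : diffOp r W j.succ = eulerOp r W j := rfl

theorem diffOp_resProd (i : Fin (r + 1)) (a b : VertexOps r W) (n : ℤ) (m : Fin r → ℤ) :
    diffOp r W i (resProd a b n m)
      = resProd (diffOp r W i a) b n m + resProd a (diffOp r W i b) n m := by
  induction i using Fin.cases with
  | zero => exact derivZero_resProd a b n m
  | succ j => exact eulerOp_resProd j a b n m

theorem resProd_diffOp_left_mem (i : Fin (r + 1)) {S : Submodule ℂ (VertexOps r W)}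
    {a b : VertexOps r W} (h : ∀ n m, resProd a b n m ∈ S) (n : ℤ) (m : Fin r → ℤ) :
    resProd (diffOp r W i a) b n m ∈ S := by
  induction i using Fin.cases with
  | zero => rw [diffOp_zero, resProd_derivZero_left]; exact S.smul_mem _ (h _ _)
  | succ j => rw [diffOp_succ, resProd_eulerOp_left]; exact S.smul_mem _ (h _ _)

theorem diffOp_mem_localSubmodule (i : Fin (r + 1)) {a b : VertexOps r W}
    (h : a ∈ localSubmodule b) : diffOp r W i a ∈ localSubmodule b := by
  obtain ⟨k, hk⟩ := h
  induction i using Fin.cases with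
  | zero =>
    refine ⟨k + 1, fun m n w p q => ?_⟩
    rw [diffOp_zero, commDiff_deriv_left _ (derivZero_row a m),
      (hk m n).commDiff_eq_zero (by omega), (hk m n).commDiff_eq_zero (by push_cast; omega),
      smul_zero, smul_zero, sub_zero]
  | succ j =>
    refine ⟨k, fun m n w p q => ?_⟩
    rw [diffOp_succ, commDiff_smul_left (b.row n) _ (eulerOp_row j a m),
      hk m n, smul_zero]

theorem diffOp_oneOp (i : Fin (r + 1)) : diffOp r W i (oneOp r W) = 0 := by
  refine VertexOps.ext_coeff fun p m w => ?_
  induction i using Fin.cases with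
  | zero =>
    rw [diffOp_zero, derivZero_coeff]
    by_cases h : p = 0
    · simp [h, VertexOps.coeff_zero]
    · simp [oneOp, h, VertexOps.coeff_zero]
  | succ j =>
    rw [diffOp_succ, eulerOp_coeff]
    by_cases h : p = -1 ∧ m = 0
    · simp [h.2, VertexOps.coeff_zero]
    · simp [oneOp, h, VertexOps.coeff_zero]

/-! ### The Jacobi identity for the residue product -/

/-- The coefficient `a_{s,t} w`, as an additive map in `a`. -/
def coeffHom (s : ℤ) (t : Fin r → ℤ) (w : W) : VertexOps r W →+ W where
  toFun a := a.coeff s t w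
  map_zero' := rfl
  map_add' _ _ := rfl

theorem coeffHom_apply (s : ℤ) (t : Fin r → ℤ) (w : W) (a : VertexOps r W) :
    coeffHom s t w a = a.coeff s t w := rfl

theorem resProd_resProd_lowerTruncated {k : ℕ} {b c : VertexOps r W} (a : VertexOps r W)
    (hbc : RowsLocal k b c) (m n : Fin r → ℤ) :
    LowerTruncated fun p q => resProd a (resProd b c q n) p m :=
  ⟨k, fun q hq p => by dsimp only; rw [hbc.resProd_eq_zero hq, resProd_zero_right]⟩

/-- The Jacobi identity for the products of three mutually local elements of `VertexOps r W`. -/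
theorem resProd_jacobi {k : ℕ} {a b c : VertexOps r W} (hab : RowsLocal k a b)
    (hbc : RowsLocal k b c) (hac : RowsLocal k a c) (l p q : ℤ) (m n : Fin r → ℤ) :
    borcherdsDiff (fun p q => resProd a (resProd b c q n) p m)
        (fun q p => resProd b (resProd a c p m) q n) l p q
      = ∑ᶠ i : ℕ, Ring.choose p i • resProd (resProd a b (l + i) m) c (p + q - i) (m + n) := by
  refine VertexOps.ext_coeff fun s t w => ?_
  rw [← coeffHom_apply, ← coeffHom_apply,
    map_borcherdsDiff (resProd_resProd_lowerTruncated a hbc m n)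
    (resProd_resProd_lowerTruncated b hac n m)]
  have hfin : (Function.support fun i : ℕ =>
      Ring.choose p i • resProd (resProd a b (l + i) m) c (p + q - i) (m + n)).Finite :=
    finite_support_of_eventually_zero (k - l).toNat fun i hi => by
      rw [hab.resProd_eq_zero (by omega), resProd_zero_left, smul_zero]
  rw [AddMonoidHom.map_finsum _ hfin]
  have h := borcherds_identity (hab m n) (hac m (t - (m + n))) (hbc n (t - (m + n))) w l p q s
  refine Eq.trans ?_ (h.trans (finsum_congr fun i => ?_))
  · have e1 : t - (m + n) = t - m - n := by abel
    have e2 : t - (m + n) = t - n - m := by abel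
    unfold nestedDiff borcherdsDiff
    congr 2
    · rw [e1]; rfl
    · rw [e2]; rfl
  · rw [map_zsmul]
    change _ = _ • prod (prod (a.row m) (b.row (m + n - m)) (l + i)) (c.row (t - (m + n))) _ s w
    rw [add_sub_cancel_left]

/-- The Jacobi identity for the action of mutually local elements of `VertexOps r W` on `W`. -/
theorem commDiff_row_eq_finsum {k : ℕ} {a b : VertexOps r W} (hab : RowsLocal k a b) (w : W)
    (l p q : ℤ) (m n : Fin r → ℤ) :
    commDiff (a.row m) (b.row n) w l p q
      = ∑ᶠ i : ℕ, Ring.choose p i • (resProd a b (l + i) m).coeff (p + q - i) (m + n) w := by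
  rw [eq_finsum_of_recursion (commDiff_succ (a.row m) (b.row n) w) (hab m n w) l p q]
  refine finsum_congr fun i => ?_
  rw [resProd_coeff, add_sub_cancel_left]

theorem finsum_negOnePow_smul {M : Type*} [AddCommGroup M] {ψ : ℤ → ℤ → M}
    (hψ : LowerTruncated ψ) (l q p : ℤ) :
    ∑ᶠ i : ℕ, ((l.negOnePow : ℤ) * (-1 : ℤ) ^ i * Ring.choose l i) • ψ (q + l - i) (p + i)
      = (l.negOnePow : ℤ) • binExp l ψ q p := by
  rw [binExp, smul_finsum' _ (hψ.finite_support _ _ _)]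
  exact finsum_congr fun i => by rw [mul_assoc, smul_smul]

theorem binExp_mem {S : Submodule ℂ (VertexOps r W)} {φ : ℤ → ℤ → VertexOps r W}
    (h : ∀ p q, φ p q ∈ S) (l p q : ℤ) : binExp l φ p q ∈ S :=
  finsum_induction (· ∈ S) S.zero_mem (fun _ _ => S.add_mem) fun _ =>
    S.toAddSubgroup.zsmul_mem (h _ _) _

end Derivations

/-! ### The subspace generated by a local set -/

section Generated

variable {r : ℕ} {W : Type*} [AddCommGroup W] [Module ℂ W]

theorem isLocal_iff {S : Set (VertexOps r W)} :
    IsLocal S ↔ ∀ a ∈ S, ∀ b ∈ S, a ∈ localSubmodule b :=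
  forall₂_congr fun _ _ => forall₂_congr fun _ _ => mutuallyLocal_iff

theorem comp_eq_resProd_of_mem {a b : VertexOps r W} (h : a ∈ localSubmodule b)
    (hab : Compatible a b) (n : ℤ) (m : Fin r → ℤ) : comp a b hab n m = resProd a b n m :=
  comp_eq_resProd h.choose_spec hab n m

theorem compatible_of_mem {a b : VertexOps r W} (h : a ∈ localSubmodule b) : Compatible a b :=
  h.choose_spec.compatible

theorem isClosedSubspace_iff {S : Submodule ℂ (VertexOps r W)}
    (hS : ∀ a ∈ S, ∀ b ∈ S, a ∈ localSubmodule b) :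
    IsClosedSubspace S ↔ ∀ a ∈ S, ∀ b ∈ S, ∀ n m, resProd a b n m ∈ S := by
  refine forall₂_congr fun a ha => forall₂_congr fun b hb => ⟨fun h n m => ?_, fun h hab n m => ?_⟩
  · rw [← comp_eq_resProd_of_mem (hS a ha b hb) (compatible_of_mem (hS a ha b hb))]
    exact h _ n m
  · rw [comp_eq_resProd_of_mem (hS a ha b hb)]
    exact h n m

theorem pairwise_local_insert_oneOp {U : Set (VertexOps r W)} (hU : IsLocal U) :
    ∀ a ∈ U ∪ {oneOp r W}, ∀ b ∈ U ∪ {oneOp r W}, a ∈ localSubmodule b := by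
  rintro a (ha | rfl) b (hb | rfl)
  · exact isLocal_iff.1 hU a ha b hb
  · exact mem_localSubmodule_comm (oneOp_mem_localSubmodule a)
  · exact oneOp_mem_localSubmodule b
  · exact oneOp_mem_localSubmodule _

section

variable {A : Set (VertexOps r W)}

theorem IteratedProduct.mem_localSubmodule_of_mem
    (hA : ∀ a ∈ A, ∀ b ∈ A, a ∈ localSubmodule b)
    {c : VertexOps r W} (hc : IteratedProduct A c) :
    ∀ d ∈ A, c ∈ localSubmodule d := by
  induction hc with
  | base b hb => exact hA b hb
  | step a c ha hc hac m₀ m ih =>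
    intro d hd
    have hac' : a ∈ localSubmodule c := mem_localSubmodule_comm (ih a ha)
    rw [comp_eq_resProd_of_mem hac']
    exact resProd_mem_localSubmodule hac' (ih d hd) (hA a ha d hd) m₀ m

theorem IteratedProduct.mem_localSubmodule
    (hA : ∀ a ∈ A, ∀ b ∈ A, a ∈ localSubmodule b)
    {c d : VertexOps r W} (hc : IteratedProduct A c)
    (hd : IteratedProduct A d) : c ∈ localSubmodule d := by
  induction hc with
  | base b hb => exact mem_localSubmodule_comm (hd.mem_localSubmodule_of_mem hA b hb)
  | step a c ha hc hac m₀ m ih =>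
    have hac' : a ∈ localSubmodule c :=
      mem_localSubmodule_comm (hc.mem_localSubmodule_of_mem hA a ha)
    rw [comp_eq_resProd_of_mem hac']
    exact resProd_mem_localSubmodule hac' ih
      (mem_localSubmodule_comm (hd.mem_localSubmodule_of_mem hA a ha)) m₀ m

theorem span_iteratedProduct_local
    (hA : ∀ a ∈ A, ∀ b ∈ A, a ∈ localSubmodule b) :
    ∀ a ∈ Submodule.span ℂ {c | IteratedProduct A c},
      ∀ b ∈ Submodule.span ℂ {c | IteratedProduct A c}, a ∈ localSubmodule b := by
  have h1 : ∀ d, IteratedProduct A d →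
      Submodule.span ℂ {c | IteratedProduct A c} ≤ localSubmodule d := fun d hd =>
    Submodule.span_le.2 fun c hc => IteratedProduct.mem_localSubmodule hA hc hd
  intro a ha b hb
  refine mem_localSubmodule_comm ((Submodule.span_le (p := localSubmodule a)).2 ?_ hb)
  exact fun d hd => mem_localSubmodule_comm (h1 d hd ha)

/-- The span of the iterated products is closed under all products: the iterate formula rewrites
`(a_{l,m} c)_{q,n} y` in terms of products `a (c y)` and `c (a y)`. -/
theorem resProd_mem_span_iteratedProduct
    (hA : ∀ a ∈ A, ∀ b ∈ A, a ∈ localSubmodule b)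
    {x y : VertexOps r W}
    (hx : x ∈ Submodule.span ℂ {c | IteratedProduct A c})
    (hy : y ∈ Submodule.span ℂ {c | IteratedProduct A c}) (n : ℤ) (m : Fin r → ℤ) :
    resProd x y n m ∈ Submodule.span ℂ {c | IteratedProduct A c} := by
  set S := Submodule.span ℂ {c | IteratedProduct A c} with hS
  have hlocal : ∀ a ∈ S, ∀ b ∈ S, a ∈ localSubmodule b := span_iteratedProduct_local hA
  have hmem : ∀ c, IteratedProduct A c → c ∈ S := fun c hc => Submodule.subset_span hc
  have hbase : ∀ a ∈ A, ∀ y ∈ S, ∀ n m, resProd a y n m ∈ S := by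
    intro a ha y hy n m
    induction hy using Submodule.span_induction with
    | mem c hc =>
      have hac := hlocal a (hmem a (.base a ha)) c (hmem c hc)
      rw [← comp_eq_resProd_of_mem hac (compatible_of_mem hac)]
      exact hmem _ (.step a c ha hc _ n m)
    | zero => rw [resProd_zero_right]; exact S.zero_mem
    | add y z _ _ hy hz => rw [resProd_add_right]; exact S.add_mem hy hz
    | smul c y _ hy => rw [resProd_smul_right]; exact S.smul_mem c hy
  have hiter : ∀ x, IteratedProduct A x → ∀ y ∈ S, ∀ n m, resProd x y n m ∈ S := by
    intro x hx
    induction hx with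
    | base a ha => exact hbase a ha
    | step a c ha hc hac l m' ih =>
      intro y hy n m
      have hac' := hlocal a (hmem a (.base a ha)) c (hmem c hc)
      rw [comp_eq_resProd_of_mem hac']
      obtain ⟨k, h1, h2, h3⟩ := exists_common_order hac' (hlocal c (hmem c hc) y hy)
        (hlocal a (hmem a (.base a ha)) y hy)
      -- at `p = 0` only the term `i = 0` of the Jacobi identity remains on the right
      have hj := resProd_jacobi h1 h2 h3 l 0 n m' (m - m')
      rw [finsum_eq_single _ 0 fun i hi => by
        rw [Ring.choose_zero_pos ℤ (Nat.pos_of_ne_zero hi), zero_smul]] at hj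
      rw [Ring.choose_zero_right, one_smul, Nat.cast_zero, add_zero, zero_add, sub_zero,
        add_sub_cancel] at hj
      rw [← hj]
      exact S.sub_mem (binExp_mem (fun p q => hbase a ha _ (ih y hy _ _) _ _) _ _ _)
        (S.toAddSubgroup.zsmul_mem
          (binExp_mem (fun q p => ih _ (hbase a ha y hy _ _) _ _) _ _ _) _)
  induction hx using Submodule.span_induction with
  | mem c hc => exact hiter c hc y hy n m
  | zero => rw [resProd_zero_left]; exact S.zero_mem
  | add x z _ _ hx hz => rw [resProd_add_left]; exact S.add_mem hx hz
  | smul c x _ hx => rw [resProd_smul_left]; exact S.smul_mem c hx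

end

/-! ### The span of the derivatives of a subspace -/

theorem le_polyDiff (S : Submodule ℂ (VertexOps r W)) : S ≤ polyDiff S :=
  fun a ha => Submodule.subset_span ⟨1, one_mem _, a, ha, rfl⟩

theorem diffOp_mem_polyDiff {S : Submodule ℂ (VertexOps r W)} (i : Fin (r + 1))
    {a : VertexOps r W} (ha : a ∈ polyDiff S) : diffOp r W i a ∈ polyDiff S := by
  have h : polyDiff S ≤ (polyDiff S).comap (diffOp r W i) := by
    refine Submodule.span_le.2 ?_
    rintro _ ⟨P, hP, a, ha, rfl⟩
    exact Submodule.subset_span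
      ⟨diffOp r W i * P, mul_mem (Algebra.subset_adjoin ⟨i, rfl⟩) hP, a, ha, rfl⟩
  exact h ha

/-- `polyDiff S` is the smallest subspace containing `S` and stable under all `D_i`. -/
theorem polyDiff_le {S T : Submodule ℂ (VertexOps r W)} (hST : S ≤ T)
    (hT : ∀ i, ∀ a ∈ T, diffOp r W i a ∈ T) : polyDiff S ≤ T := by
  refine Submodule.span_le.2 ?_
  rintro _ ⟨P, hP, a, ha, rfl⟩
  have h : ∀ a ∈ T, P a ∈ T := by
    induction hP using Algebra.adjoin_induction with
    | mem P hP =>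
      obtain ⟨i, rfl⟩ := hP
      exact hT i
    | algebraMap c => exact fun a ha => T.smul_mem c ha
    | add P Q _ _ hP hQ => exact fun a ha => T.add_mem (hP a ha) (hQ a ha)
    | mul P Q _ _ hP hQ => exact fun a ha => hP _ (hQ a ha)
  exact h a (hST ha)

theorem polyDiff_local {S : Submodule ℂ (VertexOps r W)}
    (hS : ∀ a ∈ S, ∀ b ∈ S, a ∈ localSubmodule b) :
    ∀ a ∈ polyDiff S, ∀ b ∈ polyDiff S, a ∈ localSubmodule b := by
  have h1 : ∀ b ∈ S, polyDiff S ≤ localSubmodule b := fun b hb =>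
    polyDiff_le (fun a ha => hS a ha b hb) fun i a => diffOp_mem_localSubmodule i
  intro a ha b hb
  have h2 : polyDiff S ≤ localSubmodule a :=
    polyDiff_le (fun b hb => mem_localSubmodule_comm (h1 b hb ha))
      fun i a => diffOp_mem_localSubmodule i
  exact mem_localSubmodule_comm (h2 hb)

theorem resProd_mem_polyDiff {S : Submodule ℂ (VertexOps r W)}
    (hS : ∀ a ∈ S, ∀ b ∈ S, ∀ n m, resProd a b n m ∈ S) {a b : VertexOps r W}
    (ha : a ∈ polyDiff S) (hb : b ∈ polyDiff S) (n : ℤ) (m : Fin r → ℤ) :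
    resProd a b n m ∈ polyDiff S := by
  let L (b : VertexOps r W) : Submodule ℂ (VertexOps r W) :=
    { carrier := {a | ∀ n m, resProd a b n m ∈ polyDiff S}
      zero_mem' := fun n m => by rw [resProd_zero_left]; exact Submodule.zero_mem _
      add_mem' := fun ha ha' n m => by
        rw [resProd_add_left]; exact Submodule.add_mem _ (ha n m) (ha' n m)
      smul_mem' := fun c a ha n m => by
        rw [resProd_smul_left]; exact Submodule.smul_mem _ c (ha n m) }
  let R (a : VertexOps r W) : Submodule ℂ (VertexOps r W) :=
    { carrier := {b | ∀ n m, resProd a b n m ∈ polyDiff S}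
      zero_mem' := fun n m => by rw [resProd_zero_right]; exact Submodule.zero_mem _
      add_mem' := fun hb hb' n m => by
        rw [resProd_add_right]; exact Submodule.add_mem _ (hb n m) (hb' n m)
      smul_mem' := fun c b hb n m => by
        rw [resProd_smul_right]; exact Submodule.smul_mem _ c (hb n m) }
  have h1 : ∀ b ∈ S, polyDiff S ≤ L b := fun b hb =>
    polyDiff_le (fun a ha n m => le_polyDiff S (hS a ha b hb n m))
      fun i a ha n m => resProd_diffOp_left_mem i ha n m
  have h2 : polyDiff S ≤ R a := by
    refine polyDiff_le (fun b hb => h1 b hb ha) fun i b hb n m => ?_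
    have h3 := diffOp_resProd i a b n m
    rw [eq_comm, ← eq_sub_iff_add_eq'] at h3
    rw [h3]
    exact Submodule.sub_mem _ (diffOp_mem_polyDiff i (hb n m))
      (resProd_diffOp_left_mem i hb n m)
  exact h2 hb n m

end Generated

/-! ### Toroidal vertex algebras of mutually local fields -/

section Construction

variable {r : ℕ} {W : Type*} [AddCommGroup W] [Module ℂ W] (S : Submodule ℂ (VertexOps r W))

/-- A subspace of mutually local fields which contains the identity field and is closed under the
residue products. -/
structure IsFieldAlgebra : Prop where
  isLocal : ∀ a ∈ S, ∀ b ∈ S, a ∈ localSubmodule b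
  resProd_mem : ∀ a ∈ S, ∀ b ∈ S, ∀ n m, resProd a b n m ∈ S
  one_mem : oneOp r W ∈ S

variable {S}

theorem IsFieldAlgebra.exists_common_order (hS : IsFieldAlgebra S) (a b c : S) :
    ∃ k, RowsLocal k (a : VertexOps r W) b ∧ RowsLocal k (b : VertexOps r W) c ∧
      RowsLocal k (a : VertexOps r W) c :=
  Toroidal.exists_common_order (hS.isLocal a a.2 b b.2) (hS.isLocal b b.2 c c.2)
    (hS.isLocal a a.2 c c.2)

/-- The vertex operator map `Y_E` on a field algebra. -/
noncomputable def IsFieldAlgebra.vertexOp (hS : IsFieldAlgebra S) : S →ₗ[ℂ] VertexOps r S where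
  toFun a :=
    { coeff := fun n m =>
        { toFun := fun b => ⟨resProd a b n m, hS.resProd_mem a a.2 b b.2 n m⟩
          map_add' := fun b b' => Subtype.ext (resProd_add_right _ _ _ n m)
          map_smul' := fun c b => Subtype.ext (resProd_smul_right c _ _ n m) }
      truncated := fun b => by
        obtain ⟨k, hk⟩ := hS.isLocal a a.2 b b.2
        exact ⟨k, fun n hn m => Subtype.ext (hk.resProd_eq_zero hn m)⟩ }
  map_add' a a' := VertexOps.ext_coeff fun n m b => Subtype.ext (resProd_add_left _ _ _ n m)
  map_smul' c a := VertexOps.ext_coeff fun n m b => Subtype.ext (resProd_smul_left c _ _ n m)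

theorem IsFieldAlgebra.coe_vertexOp (hS : IsFieldAlgebra S) (a b : S) (n : ℤ)
    (m : Fin r → ℤ) : ((hS.vertexOp a).coeff n m b : VertexOps r W) = resProd a b n m := rfl

theorem VertexOps.finite_support_coeff {V : Type*} [AddCommGroup V] [Module ℂ V]
    (a : VertexOps r V) (v : V) (q : ℤ) (c : ℕ → ℤ) (m : Fin r → ℤ) {N : Type*} [AddCommGroup N]
    (g : ℕ → V →+ N) :
    (Function.support fun i : ℕ => c i • g i (a.coeff (q + i) m v)).Finite := by
  obtain ⟨Q, hQ⟩ := a.truncated v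
  exact finite_support_of_eventually_zero (Q - q).toNat fun i hi => by
    rw [hQ _ (by omega), map_zero, smul_zero]

theorem IsFieldAlgebra.jacobi_self (hS : IsFieldAlgebra S) :
    JacobiIdentity hS.vertexOp hS.vertexOp := by
  intro a b c p q l m n
  obtain ⟨k, hab, hbc, hac⟩ := hS.exists_common_order a b c
  have h := resProd_jacobi hab hbc hac l p q m n
  have hfin₁ : (Function.support fun i : ℕ => ((-1 : ℤ) ^ i * Ring.choose l i) •
      (hS.vertexOp a).coeff (p + l - i) m ((hS.vertexOp b).coeff (q + i) n c)).Finite :=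
    (hS.vertexOp b).finite_support_coeff c q _ n
      fun i => ((hS.vertexOp a).coeff (p + l - i) m).toAddMonoidHom
  have hfin₂ : (Function.support fun i : ℕ =>
      ((l.negOnePow : ℤ) * (-1 : ℤ) ^ i * Ring.choose l i) •
      (hS.vertexOp b).coeff (q + l - i) n ((hS.vertexOp a).coeff (p + i) m c)).Finite :=
    (hS.vertexOp a).finite_support_coeff c p _ m
      fun i => ((hS.vertexOp b).coeff (q + l - i) n).toAddMonoidHom
  have hfin₃ : (Function.support fun i : ℕ => Ring.choose p i •
      (hS.vertexOp ((hS.vertexOp a).coeff (l + i) m b)).coeff (p + q - i) (m + n) c).Finite :=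
    finite_support_of_eventually_zero (k - l).toNat fun i hi => by
      have h0 : (hS.vertexOp a).coeff (l + i) m b = 0 :=
        Subtype.ext (hab.resProd_eq_zero (by omega) m)
      rw [h0, map_zero, VertexOps.coeff_zero, LinearMap.zero_apply, smul_zero]
  refine Subtype.ext ?_
  rw [Submodule.coe_sub]
  change S.subtype.toAddMonoidHom _ - S.subtype.toAddMonoidHom _ = S.subtype.toAddMonoidHom _
  rw [AddMonoidHom.map_finsum _ hfin₁, AddMonoidHom.map_finsum _ hfin₂,
    AddMonoidHom.map_finsum _ hfin₃]
  refine Eq.trans (congrArg₂ (· - ·) (finsum_congr fun i => map_zsmul _ _ _) ?_)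
    (h.trans (finsum_congr fun i => (map_zsmul S.subtype.toAddMonoidHom (Ring.choose p i)
        ((hS.vertexOp ((hS.vertexOp a).coeff (l + i) m b)).coeff (p + q - i) (m + n) c)).symm))
  exact Eq.trans (finsum_congr fun i => map_zsmul _ _ _)
    (finsum_negOnePow_smul (resProd_resProd_lowerTruncated (b : VertexOps r W) hac n m) l q p)

theorem IsFieldAlgebra.jacobi_subtype (hS : IsFieldAlgebra S) :
    JacobiIdentity hS.vertexOp S.subtype := by
  intro a b w p q l m n
  obtain ⟨k, hab⟩ := hS.isLocal a a.2 b b.2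
  refine Eq.trans (congrArg₂ (· - ·) rfl ?_) (commDiff_row_eq_finsum hab w l p q m n)
  exact finsum_negOnePow_smul
    (OneVarField.word_lowerTruncated ((b : VertexOps r W).row n) ((a : VertexOps r W).row m) w)
    l q p

/-- The toroidal vertex algebra structure on a field algebra. -/
noncomputable def IsFieldAlgebra.toroidal (hS : IsFieldAlgebra S) : ToroidalVertexAlgebra r S where
  Y := hS.vertexOp
  vac := ⟨oneOp r W, hS.one_mem⟩
  vacuum := VertexOps.ext_coeff fun n m b => Subtype.ext <| by
    rw [hS.coe_vertexOp, resProd_oneOp_left]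
    simp only [oneOp]
    split_ifs <;> rfl
  creation a n m hn := Subtype.ext (resProd_oneOp_right _ hn m)
  jacobi := hS.jacobi_self

theorem IsFieldAlgebra.isCanonicalStructure (hS : IsFieldAlgebra S) :
    IsCanonicalStructure hS.toroidal :=
  ⟨rfl, fun a b => ⟨compatible_of_mem (hS.isLocal a a.2 b b.2), fun n m =>
    (comp_eq_resProd_of_mem (hS.isLocal a a.2 b b.2) _ n m).symm⟩⟩

/-- The module structure on `W` over a field algebra, each field acting as itself. -/
noncomputable def IsFieldAlgebra.module (hS : IsFieldAlgebra S) :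
    ToroidalModule hS.toroidal W where
  YW := S.subtype
  vacuum := rfl
  jacobi := hS.jacobi_subtype

/-- The extended toroidal vertex algebra structure on a field algebra which is stable under the
derivations `D_i`. -/
noncomputable def IsFieldAlgebra.extended (hS : IsFieldAlgebra S)
    (hD : ∀ i, ∀ a ∈ S, diffOp r W i a ∈ S) : ExtendedToroidalVertexAlgebra r S where
  toToroidalVertexAlgebra := hS.toroidal
  D i := (diffOp r W i).restrict (hD i)
  D_vac i := Subtype.ext (diffOp_oneOp i)
  D_comm i a n m := LinearMap.ext fun b => Subtype.ext <|
    sub_eq_of_eq_add (diffOp_resProd i (a : VertexOps r W) b n m)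
  Y_D i a := by
    refine VertexOps.ext_coeff fun n m b => Subtype.ext ?_
    induction i using Fin.cases with
    | zero => exact resProd_derivZero_left (a : VertexOps r W) b n m
    | succ j => exact resProd_eulerOp_left j (a : VertexOps r W) b n m

end Construction

/-! ### The two field algebras of a local set -/

section FieldAlgebras

variable {r : ℕ} {W : Type*} [AddCommGroup W] [Module ℂ W] {U : Set (VertexOps r W)}

theorem isFieldAlgebra_generated (hU : IsLocal U) : IsFieldAlgebra (generated U) where
  isLocal := span_iteratedProduct_local (pairwise_local_insert_oneOp hU)
  resProd_mem _ ha _ hb :=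
    resProd_mem_span_iteratedProduct (pairwise_local_insert_oneOp hU) ha hb
  one_mem := Submodule.subset_span (.base _ (Or.inr rfl))

theorem IsFieldAlgebra.polyDiff {S : Submodule ℂ (VertexOps r W)} (hS : IsFieldAlgebra S) :
    IsFieldAlgebra (polyDiff S) where
  isLocal := polyDiff_local hS.isLocal
  resProd_mem _ ha _ hb := resProd_mem_polyDiff hS.resProd_mem ha hb
  one_mem := le_polyDiff S hS.one_mem

theorem isLeast_generated (hU : IsLocal U) :
    IsLeast {S : Submodule ℂ (VertexOps r W) |
        IsLocal (S : Set (VertexOps r W)) ∧ IsClosedSubspace S ∧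
          U ∪ {oneOp r W} ⊆ (S : Set (VertexOps r W))}
      (generated U) := by
  have hS := isFieldAlgebra_generated hU
  refine ⟨⟨isLocal_iff.2 hS.isLocal, (isClosedSubspace_iff hS.isLocal).2 hS.resProd_mem,
    fun a ha => Submodule.subset_span (.base a ha)⟩, ?_⟩
  rintro T ⟨-, hclosed, hUT⟩
  refine Submodule.span_le.2 fun c hc => ?_
  induction hc with
  | base b hb => exact hUT hb
  | step a c ha _ hac n m ih => exact hclosed a (hUT ha) c ih hac n m

end FieldAlgebras

end Toroidal

theorem theorem3p7 (r : ℕ) (hr : 0 < r) (W : Type*) [AddCommGroup W] [Module ℂ W]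
    (U : Set (VertexOps r W)) (hU : IsLocal U) :
    -- `⟨U⟩` is the smallest closed local subspace containing `U ∪ {1_W}`
    IsLeast {S : Submodule ℂ (VertexOps r W) |
        IsLocal (S : Set (VertexOps r W)) ∧ IsClosedSubspace S ∧
          U ∪ {oneOp r W} ⊆ (S : Set (VertexOps r W))}
      (generated U) ∧
    -- `(⟨U⟩, Y_E, 1_W)` is a toroidal vertex algebra with `W` as a faithful module,
    -- where `a(x₀, x)` acts on `W` as itself
    (∃ T : ToroidalVertexAlgebra r (generated U), IsCanonicalStructure T ∧
      ∃ M : ToroidalModule T W,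
        (∀ a : generated U, M.YW a = (a : VertexOps r W)) ∧ M.IsFaithful) ∧
    -- `ℂ[D₀, …, D_r]⟨U⟩` is an extended toroidal vertex algebra, with `𝓓_i = D_i`,
    -- and `W` is a module for the underlying toroidal vertex algebra
    (∃ T : ExtendedToroidalVertexAlgebra r (polyDiff (generated U)),
      IsCanonicalStructure T.toToroidalVertexAlgebra ∧
      (∀ (i : Fin (r + 1)) (a : polyDiff (generated U)),
        (T.D i a : VertexOps r W) = diffOp r W i (a : VertexOps r W)) ∧
      ∃ M : ToroidalModule T.toToroidalVertexAlgebra W,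
        ∀ a : polyDiff (generated U), M.YW a = (a : VertexOps r W)) := by
  have hS := isFieldAlgebra_generated hU
  exact ⟨isLeast_generated hU,
    ⟨hS.toroidal, hS.isCanonicalStructure, hS.module, fun _ => rfl, Subtype.val_injective⟩,
    ⟨hS.polyDiff.extended fun i _ => diffOp_mem_polyDiff i, hS.polyDiff.isCanonicalStructure,
      fun _ _ => rfl, hS.polyDiff.module, fun _ => rfl⟩⟩
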